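/- **Existence of bound fermion pairs.** *The model.* Let $|\cdot|$ be the Euclidean norm on $\mathbb{Z}^2$. Fix $U\ge 0$, $h_b\ge 0$, $\kappa>0$ and a real function $v\in\ell^1(\mathbb{Z}^2;\mathbb{R})$ with $v(x)=v(-x)$ and $v(x_1,x_2)=v(-x_2,x_1)$. For a hopping amplitude $\epsilon\ge 0$ consider, on the tensor product of the Fock space of spin-$\tfrac12$ fermions on $\mathbb{Z}^2$ (operators $a_{x,s},a^*_{x,s}$, $s\in\{\uparrow,\downarrow\}$, $n_{x,s}=a^*_{x,s}a_{x,s}$) and the Fock space of spinless bosons on $\mathbb{Z}^2$ (operators $b_x,b_x^*$), the Hamiltonian $\mathbf H=H_f+H_b+W$ with $$H_f=\epsilon\Big(-\tfrac12\sum_{s,\,|x-y|=1}a^*_{x,s}a_{y,s}+2\sum_{s,x}a^*_{x,s}a_{x,s}\Big)+U\sum_x n_{x,\uparrow}n_{x,\downarrow},$$ $$H_b=\epsilon h_b\Big(-\tfrac12\sum_{|x-y|=1}b^*_xb_y+2\sum_x b^*_xb_x\Big),\qquad W=\sum_{x,y}v(x-y)\big(b_x^*c_y+c_y^*b_x\big),\qquad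 c_x=\sum_{|z|\le1}e^{-\kappa|z|}a_{x+z,\uparrow}a_{x,\downarrow}.$$ Let $H^{(2,1)}$ be the restriction of $\mathbf H$ to the invariant subspace spanned by the states of one fermion pair (one fermion of each spin) without boson and the states of one boson without fermion. This subspace is identified with $\ell^2(\mathbb{Z}^2\times\mathbb{Z}^2)\oplus\ell^2(\mathbb{Z}^2)$, with elements $(\mathfrak c,\mathfrak b)$, in such a way that $a_{x,\uparrow}a_{y,\downarrow}(\mathfrak c)=\mathfrak c(x,y)$; the operator $H^{(2,1)}$ is bounded and self-adjoint. Put $E_0=\inf\sigma(H^{(2,1)})$; it depends on $\epsilon$. For $\varepsilon\in(0,1)$ and $E_0<0$ let $\Xi_\varepsilon$ be the set of all $C^1$ maps $t\mapsto(\mathfrak c_t,\mathfrak b_t)$ from $\mathbb{R}$ to $\mathrm{Ran}\,\mathbf 1_{[E_0,E_0(1-\varepsilon)]}(H^{(2,1)})$ with $\|(\mathfrak c_t,\mathfrak b_t)\|=1$ and $i\frac{d}{dt}(\mathfrak c_t,\mathfrak b_t)=H^{(2,1)}(\mathfrak c_t,\mathfrak b_t)$ for all $t\in\mathbb{R}$.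 *Theorem.* Let $\eta,\varepsilon\in(0,1)$. 1. For every $\epsilon\ge0$ with $E_0<0$ and every $(\mathfrak c_t,\mathfrak b_t)\in\Xi_\varepsilon$ there is $R<\infty$ such that, for all $t\in\mathbb{R}$, $$\sum_{x_\uparrow,x_\downarrow\in\mathbb{Z}^2:\,|x_\uparrow-x_\downarrow|\le R}|\mathfrak c_t(x_\uparrow,x_\downarrow)|^2\ \ge\ \|\mathfrak c_0\|_2^2\,(1-\eta)\ >\ 0 .$$ 2. There is $\epsilon_0>0$, depending only on $U,h_b,\kappa,v,\eta,\varepsilon$, such that for every $\epsilon\in(0,\epsilon_0)$ with $E_0<0$, every $(\mathfrak c_t,\mathfrak b_t)\in\Xi_\varepsilon$ and every $t\in\mathbb{R}$, the same two inequalities hold with $R=1$. -/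

import Mathlib

namespace BipolaronElectron

/-! ### Lattice, spins, coupling functions -/

/-- The lattice `ℤ²`. -/
abbrev Site : Type := ℤ × ℤ

/-- The Euclidean norm `|z|` of a lattice vector (the norm that `ℤ × ℤ` carries in the library is
the sup norm). -/
noncomputable def siteNorm (z : Site) : ℝ := Real.sqrt ((z.1 : ℝ) ^ 2 + (z.2 : ℝ) ^ 2)

/-- The spin of a fermion. -/
inductive Spin : Type
  | up
  | down
  deriving DecidableEq

instance : Fintype Spin := ⟨{.up, .down}, by rintro (_ | _) <;> simp⟩

/-- A one-fermion mode: a site and a spin, so that `ℓ²(ℤ²; ℂ²) = ℓ²(Mode)`. -/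
abbrev Mode : Type := Site × Spin

/-- A real coupling function `v ∈ ℓ¹(ℤ²; ℝ)` that is symmetric and invariant under rotations by 90
degrees. -/
structure Coupling where
  toFun : Site → ℝ
  summable : Summable fun x => |toFun x|
  even : ∀ x, toFun (-x) = toFun x
  rotation : ∀ x₁ x₂ : ℤ, toFun (-x₂, x₁) = toFun (x₁, x₂)

/-! ### Fock space and the many-body Hamiltonian -/

/-- Wave functions of finitely many fermions and bosons: `Ψ [m₁, …, mₙ] [x₁, …, xₚ]` is the value
at `((m₁, …, mₙ), (x₁, …, xₚ))` of the component of `Ψ` with `n` fermions and `p` bosons, a function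
in `ℓ²(Mode)^{⊗n} ⊗ ℓ²(ℤ²)^{⊗p}`. The vectors of the Fock space `𝓕₋ ⊗ 𝓕₊` are those wave functions
that are square summable, antisymmetric in the fermion variables and symmetric in the boson
variables; the operators below are given by pointwise formulas, hence make sense on this larger
space of functions. -/
abbrev WaveFunction : Type := List Mode → List Site → ℂ

namespace WaveFunction

/-- The fermionic annihilation operator `a_m`:
`(a_m Ψ)(m₁, …, mₙ) = √(n + 1) Ψ(m, m₁, …, mₙ)`. -/
noncomputable def fermiAnn (m : Mode) (Ψ : WaveFunction) : WaveFunction :=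
  fun l k => (Real.sqrt (l.length + 1) : ℂ) * Ψ (m :: l) k

/-- The fermionic creation operator `a_m^*`, with indices counted from `0`:
`(a_m^* Ψ)(m₀, …, mₙ₋₁) = n^{-1/2} ∑ᵢ (-1)ⁱ δ_{mᵢ, m} Ψ(m₀, …, (mᵢ omitted), …, mₙ₋₁)`. -/
noncomputable def fermiCre (m : Mode) (Ψ : WaveFunction) : WaveFunction :=
  fun l k => (Real.sqrt l.length : ℂ)⁻¹ *
    ∑ i : Fin l.length, if l[i] = m then (-1 : ℂ) ^ (i : ℕ) * Ψ (l.eraseIdx i) k else 0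

/-- The bosonic annihilation operator `b_x`. -/
noncomputable def boseAnn (x : Site) (Ψ : WaveFunction) : WaveFunction :=
  fun l k => (Real.sqrt (k.length + 1) : ℂ) * Ψ l (x :: k)

/-- The bosonic creation operator `b_x^*`. -/
noncomputable def boseCre (x : Site) (Ψ : WaveFunction) : WaveFunction :=
  fun l k => (Real.sqrt k.length : ℂ)⁻¹ *
    ∑ i : Fin k.length, if k[i] = x then Ψ l (k.eraseIdx i) else 0

/-- The fermionic number operator `n_m = a_m^* a_m`. -/
noncomputable def fermiNum (m : Mode) (Ψ : WaveFunction) : WaveFunction :=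
  fermiCre m (fermiAnn m Ψ)

/-- The set of all `z ∈ ℤ²` with `|z| ≤ 1` (their coordinates lie in `[-1, 1]`). -/
noncomputable def closeSites : Finset Site :=
  {z ∈ Finset.Icc (-1, -1) (1, 1) | siteNorm z ≤ 1}

/-- The pair annihilation operator `c_x = ∑_{|z| ≤ 1} e^{-κ|z|} a_{x+z,↑} a_{x,↓}`. -/
noncomputable def pairAnn (κ : ℝ) (x : Site) (Ψ : WaveFunction) : WaveFunction :=
  fun l k => ∑ z ∈ closeSites, (Real.exp (-κ * siteNorm z) : ℂ) *
    fermiAnn (x + z, .up) (fermiAnn (x, .down) Ψ) l k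

/-- Its adjoint `c_x^* = ∑_{|z| ≤ 1} e^{-κ|z|} a_{x,↓}^* a_{x+z,↑}^*`. -/
noncomputable def pairCre (κ : ℝ) (x : Site) (Ψ : WaveFunction) : WaveFunction :=
  fun l k => ∑ z ∈ closeSites, (Real.exp (-κ * siteNorm z) : ℂ) *
    fermiCre (x, .down) (fermiCre (x + z, .up) Ψ) l k

/-- `H_f = hop (-½ ∑_{s, |x-y|=1} a_{x,s}^* a_{y,s} + 2 ∑_{s,x} a_{x,s}^* a_{x,s})
+ U ∑_x n_{x,↑} n_{x,↓}`, where `hop ≥ 0` is the hopping amplitude and `U ≥ 0` the Hubbard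
repulsion. At each configuration only finitely many terms are non-zero. -/
noncomputable def fermiHamiltonian (hop U : ℝ) (Ψ : WaveFunction) : WaveFunction :=
  fun l k =>
    (hop : ℂ) * (-(1 / 2) * ∑ s : Spin, ∑' x : Site, ∑' y : Site,
        (if siteNorm (x - y) = 1 then fermiCre (x, s) (fermiAnn (y, s) Ψ) l k else 0)
      + 2 * ∑ s : Spin, ∑' x : Site, fermiCre (x, s) (fermiAnn (x, s) Ψ) l k)
    + (U : ℂ) * ∑' x : Site, fermiNum (x, .up) (fermiNum (x, .down) Ψ) l k

/-- `H_b = hop (-½ h_b ∑_{|x-y|=1} b_x^* b_y + 2 h_b ∑_x b_x^* b_x)`. -/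
noncomputable def boseHamiltonian (hop hb : ℝ) (Ψ : WaveFunction) : WaveFunction :=
  fun l k =>
    (hop : ℂ) * (-(hb / 2) * ∑' x : Site, ∑' y : Site,
        (if siteNorm (x - y) = 1 then boseCre x (boseAnn y Ψ) l k else 0)
      + 2 * hb * ∑' x : Site, boseCre x (boseAnn x Ψ) l k)

/-- The exchange interaction `W = ∑_{x,y} v(x-y) (b_x^* c_y + c_y^* b_x)`. At each configuration
the sums converge absolutely for square summable `Ψ`, because `v` is summable. -/
noncomputable def exchange (κ : ℝ) (v : Coupling) (Ψ : WaveFunction) : WaveFunction :=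
  fun l k => ∑' x : Site, ∑' y : Site, (v.toFun (x - y) : ℂ) *
    (boseCre x (pairAnn κ y Ψ) l k + pairCre κ y (boseAnn x Ψ) l k)

/-- The full Hamiltonian `𝐇 = H_f + H_b + W`. -/
noncomputable def hamiltonian (hop U hb κ : ℝ) (v : Coupling) (Ψ : WaveFunction) : WaveFunction :=
  fermiHamiltonian hop U Ψ + boseHamiltonian hop hb Ψ + exchange κ v Ψ

end WaveFunction

/-! ### The sector of one zero-spin fermion pair or one boson -/

/-- The Hilbert space `ℓ²(ℤ² × ℤ²) ⊕ ℓ²(ℤ²)`, with elements `(𝔠, 𝔟) = (ψ.fst, ψ.snd)`. The first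
argument of `𝔠` is the position of the spin-up fermion, the second that of the spin-down one. -/
abbrev Sector : Type :=
  WithLp 2 (lp (fun _ : Site × Site => ℂ) 2 × lp (fun _ : Site => ℂ) 2)

/-- The identification of `Sector` with a subspace of Fock space. The pair component is the
antisymmetric two-fermion function with `a_{x,↑} a_{y,↓} (𝔠) = 𝔠(x, y)`. -/
noncomputable def sectorEmbed (ψ : Sector) : WaveFunction
  | [(x, .up), (y, .down)], [] => -(Real.sqrt 2 : ℂ)⁻¹ * ψ.fst (x, y)
  | [(y, .down), (x, .up)], [] => (Real.sqrt 2 : ℂ)⁻¹ * ψ.fst (x, y)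
  | [], [x] => ψ.snd x
  | _, _ => 0

/-! ### The restriction of the full Hamiltonian to the sector exists

The facts up to `existsUnique_restriction` only serve to show that exactly one bounded operator on
`Sector` is the restriction of the full Hamiltonian, and that it is self-adjoint. -/


theorem memlp_pull {α β : Type*} {f : α → β} (hf : Function.Injective f)
    (c : lp (fun _ : β => ℂ) 2) : Memℓp (fun x : α => (c (f x) : ℂ)) 2 := by
  apply memℓp_gen
  exact ((memℓp_gen_iff (by norm_num)).1 (lp.memℓp c)).comp_injective hf

/-- Composition with an injective map `f`, as a bounded operator between the `ℓ²` spaces. -/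
noncomputable def pull {α β : Type*} {f : α → β} (hf : Function.Injective f) :
    lp (fun _ : β => ℂ) 2 →L[ℂ] lp (fun _ : α => ℂ) 2 :=
  LinearMap.mkContinuous
    { toFun := fun c => ⟨fun x => c (f x), memlp_pull hf c⟩
      map_add' := fun _ _ => rfl
      map_smul' := fun _ _ => rfl } 1 (by
    intro c
    rw [one_mul]
    refine lp.norm_le_of_tsum_le (by norm_num) (norm_nonneg _) ?_
    rw [lp.norm_rpow_eq_tsum (by norm_num) c]
    have hs : Summable fun y : β => ‖c y‖ ^ (2 : ENNReal).toReal :=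
      (memℓp_gen_iff (by norm_num)).1 (lp.memℓp c)
    exact tsum_comp_le_tsum_of_inj hs (fun i => by positivity) hf)

theorem pull_apply {α β : Type*} {f : α → β} (hf : Function.Injective f)
    (c : lp (fun _ : β => ℂ) 2) (x : α) : pull hf c x = c (f x) := rfl

theorem norm_pull_le {α β : Type*} {f : α → β} (hf : Function.Injective f) :
    ‖pull hf‖ ≤ 1 := LinearMap.mkContinuous_norm_le _ zero_le_one _

theorem apply_eq_inner {α : Type*} [DecidableEq α] (c : lp (fun _ : α => ℂ) 2) (x : α) :
    c x = inner ℂ (lp.single 2 x (1 : ℂ) : lp (fun _ : α => ℂ) 2) c := by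
  rw [lp.inner_single_left]; simp

theorem pull_adjoint_apply {α β : Type*} [DecidableEq α] [DecidableEq β] {f : α → β}
    (hf : Function.Injective f) (g : lp (fun _ : α => ℂ) 2) (x : α) :
    (ContinuousLinearMap.adjoint (pull hf) g) (f x) = g x := by
  rw [apply_eq_inner, ContinuousLinearMap.adjoint_inner_right]
  have : pull hf (lp.single 2 (f x) (1 : ℂ)) = (lp.single 2 x (1 : ℂ) : lp (fun _ : α => ℂ) 2) := by
    ext y
    rw [pull_apply]
    simp [Pi.single_apply, hf.eq_iff]
  rw [this, ← apply_eq_inner]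

theorem pull_adjoint_apply_of_notMem {α β : Type*} [DecidableEq α] [DecidableEq β] {f : α → β}
    (hf : Function.Injective f) (g : lp (fun _ : α => ℂ) 2) (y : β) (hy : ∀ x, f x ≠ y) :
    (ContinuousLinearMap.adjoint (pull hf) g) y = 0 := by
  rw [apply_eq_inner, ContinuousLinearMap.adjoint_inner_right]
  have : pull hf (lp.single 2 y (1 : ℂ)) = (0 : lp (fun _ : α => ℂ) 2) := by
    ext x
    rw [pull_apply]
    simp [hy x]
  rw [this, inner_zero_left]

/-- `𝔟 ↦ 𝔟(· + z)`. -/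
noncomputable def shift (z : Site) :
    lp (fun _ : Site => ℂ) 2 →L[ℂ] lp (fun _ : Site => ℂ) 2 :=
  pull (f := fun x => x + z) (add_left_injective z)

theorem inj_up (z : Site) :
    Function.Injective (fun p : Site × Site => (p.1 + z, p.2)) := by
  rintro ⟨a, b⟩ ⟨c, d⟩ h; simpa using h

theorem inj_down (z : Site) :
    Function.Injective (fun p : Site × Site => (p.1, p.2 + z)) := by
  rintro ⟨a, b⟩ ⟨c, d⟩ h; simpa using h

theorem inj_diag (z : Site) : Function.Injective (fun x : Site => (x + z, x)) := by
  intro a b h; exact congrArg Prod.snd h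

theorem inj_sub (z : Site) : Function.Injective (fun x : Site => x - z) := sub_left_injective

/-- Convolution by the coupling function on `ℓ²(ℤ²)`. -/
noncomputable def convOp (v : Coupling) :
    lp (fun _ : Site => ℂ) 2 →L[ℂ] lp (fun _ : Site => ℂ) 2 :=
  ∑' z : Site, (v.toFun z : ℂ) • pull (inj_sub z)

/-- `𝔠 ↦ (y ↦ ∑_{|z| ≤ 1} e^{-κ|z|} 𝔠(y + z, y))`. -/
noncomputable def pairOp (κ : ℝ) :
    lp (fun _ : Site × Site => ℂ) 2 →L[ℂ] lp (fun _ : Site => ℂ) 2 :=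
  ∑ z ∈ WaveFunction.closeSites, (Real.exp (-κ * siteNorm z) : ℂ) • pull (inj_diag z)

theorem conv_hasSum (v : Coupling) :
    HasSum (fun z : Site => (v.toFun z : ℂ) • pull (inj_sub z)) (convOp v) := by
  apply Summable.hasSum
  refine Summable.of_norm_bounded v.summable fun z => ?_
  rw [norm_smul]
  calc _ ≤ ‖(v.toFun z : ℂ)‖ * 1 := by gcongr; exact norm_pull_le _
    _ = _ := by simp

theorem hasSum_conv_apply (v : Coupling) (f : lp (fun _ : Site => ℂ) 2) (x : Site) :
    HasSum (fun y : Site => (v.toFun (x - y) : ℂ) * f y) (convOp v f x) := by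
  have h := ((conv_hasSum v).mapL (ContinuousLinearMap.apply ℂ _ f)).mapL
    (lp.evalCLM ℂ (fun _ : Site => ℂ) 2 x)
  have h' := (Equiv.subLeft x).hasSum_iff.2 h
  have e : (fun y : Site => (v.toFun (x - y) : ℂ) * f y) =
      (fun z : Site => lp.evalCLM ℂ (fun _ : Site => ℂ) 2 x
        (ContinuousLinearMap.apply ℂ _ f ((v.toFun z : ℂ) • pull (inj_sub z)))) ∘
        (Equiv.subLeft x) := by
    funext y
    change _ = (v.toFun (x - y) : ℂ) * f (x - (x - y))
    rw [sub_sub_cancel]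
  rw [e]
  exact h'

theorem hasSum_conv_adjoint_apply (v : Coupling) (f : lp (fun _ : Site => ℂ) 2) (y : Site) :
    HasSum (fun x : Site => (v.toFun (x - y) : ℂ) * f x)
      (ContinuousLinearMap.adjoint (convOp v) f y) := by
  have h1 : ∀ x, convOp v (lp.single 2 y (1 : ℂ)) x = (v.toFun (x - y) : ℂ) := by
    intro x
    refine (hasSum_conv_apply v _ x).unique ?_
    convert hasSum_single y ?_ using 1
    · simp
    · intro z hz; simp [hz]
  have h := lp.hasSum_inner (𝕜 := ℂ) (convOp v (lp.single 2 y (1 : ℂ))) f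
  rw [← ContinuousLinearMap.adjoint_inner_right, ← apply_eq_inner] at h
  have e : (fun x : Site => (v.toFun (x - y) : ℂ) * f x) =
      fun x => inner ℂ (convOp v (lp.single 2 y (1 : ℂ)) x) (f x) := by
    funext x
    rw [h1]; simp [mul_comm]
  rw [e]
  exact h

/-- The four nearest neighbours of the origin. -/
def nn : Finset Site := {(1, 0), (-1, 0), (0, 1), (0, -1)}

theorem mem_nn (z : Site) : z ∈ nn ↔ siteNorm z = 1 := by
  obtain ⟨a, b⟩ := z
  have h : siteNorm (a, b) = 1 ↔ a ^ 2 + b ^ 2 = 1 := by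
    unfold siteNorm
    rw [Real.sqrt_eq_one]
    exact_mod_cast Iff.rfl
  rw [h]
  constructor
  · intro h
    simp only [nn, Finset.mem_insert, Finset.mem_singleton, Prod.mk.injEq] at h
    rcases h with h | h | h | h <;> rcases h with ⟨rfl, rfl⟩ <;> norm_num
  · intro h
    have h1 : -1 ≤ a := by nlinarith [sq_nonneg b]
    have h2 : a ≤ 1 := by nlinarith [sq_nonneg b]
    have h3 : -1 ≤ b := by nlinarith [sq_nonneg a]
    have h4 : b ≤ 1 := by nlinarith [sq_nonneg a]
    interval_cases a <;> interval_cases b <;> simp_all [nn]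

theorem nn_neg (z : Site) (hz : z ∈ nn) : -z ∈ nn := by
  rw [mem_nn] at *
  simpa [siteNorm] using hz

theorem hop_tsum (a : Site) (F : Site → ℂ) :
    (∑' x : Site, ∑' y : Site, if siteNorm (x - y) = 1 then (if a = x then F y else 0) else 0)
      = ∑ z ∈ nn, F (a + z) := by
  rw [tsum_eq_single a]
  · rw [tsum_eq_sum (s := nn.map (addLeftEmbedding a))]
    · rw [Finset.sum_map]
      refine Finset.sum_congr rfl fun z hz => ?_
      have := nn_neg z hz
      rw [mem_nn] at this
      simp [this]
    · intro y hy
      rw [if_neg]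
      intro h
      apply hy
      rw [Finset.mem_map]
      refine ⟨y - a, ?_, by simp⟩
      have := nn_neg _ ((mem_nn _).2 h)
      simpa using this
  · intro x hx
    have : a ≠ x := fun h => hx h.symm
    simp [this]

theorem site_tsum (a : Site) (F : Site → ℂ) :
    (∑' x : Site, if a = x then F x else 0) = F a := by
  rw [tsum_eq_single a]
  · simp
  · intro x hx
    rw [if_neg fun h => hx h.symm]

open WaveFunction

theorem fermiCre_nil (m : Mode) (Ψ : WaveFunction) (k : List Site) :
    fermiCre m Ψ [] k = 0 := by
  simp [fermiCre]

theorem fermiCre_one (m p : Mode) (Ψ : WaveFunction) (k : List Site) :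
    fermiCre m Ψ [p] k = if p = m then Ψ [] k else 0 := by
  simp [fermiCre]

theorem fermiCre_two (m p q : Mode) (Ψ : WaveFunction) (k : List Site) :
    fermiCre m Ψ [p, q] k = (Real.sqrt 2 : ℂ)⁻¹ *
      ((if p = m then Ψ [q] k else 0) - if q = m then Ψ [p] k else 0) := by
  have h : ∀ F : Fin [p, q].length → ℂ, ∑ i, F i = F 0 + F 1 := Fin.sum_univ_two
  unfold fermiCre
  rw [h]
  by_cases h : p = m <;> by_cases h' : q = m <;> simp [h, h', sub_eq_add_neg]

theorem boseCre_nil (x : Site) (Ψ : WaveFunction) (l : List Mode) :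
    boseCre x Ψ l [] = 0 := by
  simp [boseCre]

theorem boseCre_one (x p : Site) (Ψ : WaveFunction) (l : List Mode) :
    boseCre x Ψ l [p] = if p = x then Ψ l [] else 0 := by
  simp [boseCre]

theorem sqrt_two_ne : (Real.sqrt 2 : ℂ) ≠ 0 := by
  simp

theorem fermiAnn_nil (m : Mode) (Ψ : WaveFunction) (k : List Site) :
    fermiAnn m Ψ [] k = Ψ [m] k := by
  simp [fermiAnn]

theorem fermiAnn_one (m p : Mode) (Ψ : WaveFunction) (k : List Site) :
    fermiAnn m Ψ [p] k = (Real.sqrt 2 : ℂ) * Ψ [m, p] k := by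
  simp [fermiAnn]; left; norm_num

theorem boseAnn_nil (x : Site) (Ψ : WaveFunction) (l : List Mode) :
    boseAnn x Ψ l [] = Ψ l [x] := by
  simp [boseAnn]

/-- `Ψ` lives on configurations with `#fermions + 2 #bosons = n`. -/
def HasCharge (n : ℤ) (Ψ : WaveFunction) : Prop :=
  ∀ l k, (l.length : ℤ) + 2 * k.length ≠ n → Ψ l k = 0

theorem HasCharge.fermiAnn {n : ℤ} {Ψ : WaveFunction} (h : HasCharge n Ψ) (m : Mode) :
    HasCharge (n - 1) (fermiAnn m Ψ) := by
  intro l k hl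
  simp only [WaveFunction.fermiAnn]
  rw [h, mul_zero]
  simp only [List.length_cons]
  push_cast
  omega

theorem HasCharge.fermiCre {n : ℤ} {Ψ : WaveFunction} (h : HasCharge n Ψ) (m : Mode) :
    HasCharge (n + 1) (fermiCre m Ψ) := by
  intro l k hl
  simp only [WaveFunction.fermiCre]
  rw [Finset.sum_eq_zero, mul_zero]
  intro i _
  rw [h, mul_zero, ite_self]
  rw [List.length_eraseIdx]
  have := i.2
  simp only [this, if_true]
  omega

theorem HasCharge.boseAnn {n : ℤ} {Ψ : WaveFunction} (h : HasCharge n Ψ) (x : Site) :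
    HasCharge (n - 2) (boseAnn x Ψ) := by
  intro l k hl
  simp only [WaveFunction.boseAnn]
  rw [h, mul_zero]
  simp only [List.length_cons]
  push_cast
  omega

theorem HasCharge.boseCre {n : ℤ} {Ψ : WaveFunction} (h : HasCharge n Ψ) (x : Site) :
    HasCharge (n + 2) (boseCre x Ψ) := by
  intro l k hl
  simp only [WaveFunction.boseCre]
  rw [Finset.sum_eq_zero, mul_zero]
  intro i _
  rw [h, ite_self]
  rw [List.length_eraseIdx]
  have := i.2
  simp only [this, if_true]
  omega

theorem HasCharge.congr {n n' : ℤ} {Ψ : WaveFunction} (h : HasCharge n Ψ) (hn : n = n') :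
    HasCharge n' Ψ := hn ▸ h

theorem HasCharge.pairAnn {n : ℤ} {Ψ : WaveFunction} (h : HasCharge n Ψ) (κ : ℝ) (x : Site) :
    HasCharge (n - 2) (pairAnn κ x Ψ) := by
  intro l k hl
  simp only [WaveFunction.pairAnn]
  refine Finset.sum_eq_zero fun z _ => ?_
  rw [((h.fermiAnn _).fermiAnn _) l k (by omega), mul_zero]

theorem HasCharge.pairCre {n : ℤ} {Ψ : WaveFunction} (h : HasCharge n Ψ) (κ : ℝ) (x : Site) :
    HasCharge (n + 2) (pairCre κ x Ψ) := by
  intro l k hl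
  simp only [WaveFunction.pairCre]
  refine Finset.sum_eq_zero fun z _ => ?_
  rw [((h.fermiCre _).fermiCre _) l k (by omega), mul_zero]

theorem HasCharge.hamiltonian {n : ℤ} {Ψ : WaveFunction} (h : HasCharge n Ψ)
    (hop U hb κ : ℝ) (v : Coupling) : HasCharge n (hamiltonian hop U hb κ v Ψ) := by
  intro l k hl
  have h1 : ∀ m m', WaveFunction.fermiCre m (WaveFunction.fermiAnn m' Ψ) l k = 0 := fun m m' =>
    ((h.fermiAnn m').fermiCre m) l k (by omega)
  have h2 : ∀ m m', fermiNum m (fermiNum m' Ψ) l k = 0 := fun m m' =>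
    ((((h.fermiAnn m').fermiCre m').fermiAnn m).fermiCre m) l k (by omega)
  have h3 : ∀ x y, WaveFunction.boseCre x (WaveFunction.boseAnn y Ψ) l k = 0 := fun x y =>
    ((h.boseAnn y).boseCre x) l k (by omega)
  have h4 : ∀ x y, WaveFunction.boseCre x (WaveFunction.pairAnn κ y Ψ) l k = 0 := fun x y =>
    ((h.pairAnn κ y).boseCre x) l k (by omega)
  have h5 : ∀ x y, WaveFunction.pairCre κ y (WaveFunction.boseAnn x Ψ) l k = 0 := fun x y =>
    ((h.boseAnn x).pairCre κ y) l k (by omega)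
  simp [WaveFunction.hamiltonian, fermiHamiltonian, boseHamiltonian, exchange, h1, h2, h3, h4, h5]

theorem hasCharge_sectorEmbed (ψ : Sector) : HasCharge 2 (sectorEmbed ψ) := by
  intro l k h
  unfold sectorEmbed
  split <;> simp_all

theorem inj_same : Function.Injective (fun x : Site => (x, x)) :=
  fun _ _ h => congrArg Prod.snd h

/-- Restriction to the diagonal. -/
noncomputable def diagOp : lp (fun _ : Site × Site => ℂ) 2 →L[ℂ] lp (fun _ : Site × Site => ℂ) 2 :=
  ContinuousLinearMap.adjoint (pull inj_same) ∘L pull inj_same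

theorem diagOp_apply (c : lp (fun _ : Site × Site => ℂ) 2) (x y : Site) :
    diagOp c (x, y) = if x = y then c (x, y) else 0 := by
  unfold diagOp
  rw [ContinuousLinearMap.comp_apply]
  split_ifs with h
  · subst h
    have := pull_adjoint_apply (inj_same) (pull inj_same c) x
    simp only [pull_apply] at this
    exact this
  · refine pull_adjoint_apply_of_notMem _ _ _ fun z hz => h ?_
    simp only [Prod.mk.injEq] at hz
    exact hz.1.symm.trans hz.2

theorem pairOp_apply (κ : ℝ) (c : lp (fun _ : Site × Site => ℂ) 2) (y : Site) :
    pairOp κ c y = ∑ z ∈ closeSites, (Real.exp (-κ * siteNorm z) : ℂ) * c (y + z, y) := by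
  simp only [pairOp, _root_.sum_apply, lp.coeFn_sum, Finset.sum_apply,
    _root_.smul_apply, lp.coeFn_smul, Pi.smul_apply, pull_apply, smul_eq_mul]

theorem pairOp_adjoint_apply (κ : ℝ) (g : lp (fun _ : Site => ℂ) 2) (x y : Site) :
    ContinuousLinearMap.adjoint (pairOp κ) g (x, y) =
      ∑ z ∈ closeSites, (Real.exp (-κ * siteNorm z) : ℂ) * if x = y + z then g y else 0 := by
  simp only [pairOp, map_sum, map_smulₛₗ, _root_.sum_apply, lp.coeFn_sum,
    Finset.sum_apply, _root_.smul_apply, lp.coeFn_smul, Pi.smul_apply, smul_eq_mul,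
    Complex.conj_ofReal]
  refine Finset.sum_congr rfl fun z _ => ?_
  congr 1
  split_ifs with h
  · subst h
    exact pull_adjoint_apply (inj_diag z) g y
  · refine pull_adjoint_apply_of_notMem _ _ _ fun w hw => h ?_
    simp only [Prod.mk.injEq] at hw
    rw [← hw.1, hw.2]

/-- Kinetic energy and Hubbard repulsion of one pair. -/
noncomputable def pairKinetic (hop U : ℝ) :
    lp (fun _ : Site × Site => ℂ) 2 →L[ℂ] lp (fun _ : Site × Site => ℂ) 2 :=
  (hop : ℂ) • (-(1 / 2 : ℂ) • ∑ z ∈ nn, (pull (inj_up z) + pull (inj_down z))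
    + (4 : ℂ) • ContinuousLinearMap.id ℂ _) + (U : ℂ) • diagOp

/-- Kinetic energy of one boson. -/
noncomputable def boseKinetic (hop hb : ℝ) :
    lp (fun _ : Site => ℂ) 2 →L[ℂ] lp (fun _ : Site => ℂ) 2 :=
  (hop : ℂ) • (-(hb / 2 : ℂ) • ∑ z ∈ nn, shift z + (2 * hb : ℂ) • ContinuousLinearMap.id ℂ _)

/-- The explicit bounded operator on the sector; the theorems below show that it is the restriction
of the full Hamiltonian. -/
noncomputable def sectorOp (hop U hb κ : ℝ) (v : Coupling) : Sector →L[ℂ] Sector :=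
  (WithLp.prodContinuousLinearEquiv 2 ℂ _ _).symm.toContinuousLinearMap ∘L
    ((pairKinetic hop U ∘L WithLp.fstL 2 ℂ _ _
        + ContinuousLinearMap.adjoint (convOp v ∘L pairOp κ) ∘L WithLp.sndL 2 ℂ _ _).prod
      ((convOp v ∘L pairOp κ) ∘L WithLp.fstL 2 ℂ _ _ + boseKinetic hop hb ∘L WithLp.sndL 2 ℂ _ _))

theorem sectorOp_fst (hop U hb κ : ℝ) (v : Coupling) (ψ : Sector) (x y : Site) :
    (sectorOp hop U hb κ v ψ).fst (x, y) =
      (hop : ℂ) * (-(1 / 2) * ∑ z ∈ nn, (ψ.fst (x + z, y) + ψ.fst (x, y + z)) + 4 * ψ.fst (x, y))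
      + U * (if x = y then ψ.fst (x, y) else 0)
      + ∑ z ∈ closeSites, (Real.exp (-κ * siteNorm z) : ℂ) *
          if x = y + z then ∑' w : Site, (v.toFun (w - y) : ℂ) * ψ.snd w else 0 := by
  have h : (sectorOp hop U hb κ v ψ).fst =
    pairKinetic hop U ψ.fst + ContinuousLinearMap.adjoint (convOp v ∘L pairOp κ) ψ.snd := rfl
  rw [h, ContinuousLinearMap.adjoint_comp, ContinuousLinearMap.comp_apply, lp.coeFn_add,
    Pi.add_apply, pairOp_adjoint_apply, (hasSum_conv_adjoint_apply v ψ.snd y).tsum_eq]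
  congr 1
  simp only [pairKinetic, _root_.add_apply, _root_.smul_apply,
    _root_.sum_apply, lp.coeFn_add, lp.coeFn_smul, lp.coeFn_sum, Pi.add_apply,
    Pi.smul_apply, Finset.sum_apply, smul_eq_mul, diagOp_apply, pull_apply,
    ContinuousLinearMap.id_apply]

theorem sectorOp_snd (hop U hb κ : ℝ) (v : Coupling) (ψ : Sector) (x : Site) :
    (sectorOp hop U hb κ v ψ).snd x =
      (∑' y : Site, (v.toFun (x - y) : ℂ) *
        ∑ z ∈ closeSites, (Real.exp (-κ * siteNorm z) : ℂ) * ψ.fst (y + z, y))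
      + (hop : ℂ) * (-(hb / 2) * ∑ z ∈ nn, ψ.snd (x + z) + 2 * hb * ψ.snd x) := by
  have h : (sectorOp hop U hb κ v ψ).snd =
    convOp v (pairOp κ ψ.fst) + boseKinetic hop hb ψ.snd := rfl
  rw [h, lp.coeFn_add, Pi.add_apply, ← (hasSum_conv_apply v (pairOp κ ψ.fst) x).tsum_eq]
  simp only [pairOp_apply, boseKinetic, _root_.add_apply, _root_.smul_apply,
    _root_.sum_apply, lp.coeFn_add, lp.coeFn_smul, lp.coeFn_sum, Pi.add_apply,
    Pi.smul_apply, Finset.sum_apply, smul_eq_mul, shift, pull_apply,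
    ContinuousLinearMap.id_apply]

theorem hamiltonian_boson (hop U hb κ : ℝ) (v : Coupling) (ψ : Sector) (x : Site) :
    hamiltonian hop U hb κ v (sectorEmbed ψ) [] [x] = (sectorOp hop U hb κ v ψ).snd x := by
  have hP : ∀ y, pairAnn κ y (sectorEmbed ψ) [] [] =
      ∑ z ∈ closeSites, (Real.exp (-κ * siteNorm z) : ℂ) * ψ.fst (y + z, y) := by
    intro y
    simp only [pairAnn, fermiAnn_nil, fermiAnn_one, sectorEmbed]
    refine Finset.sum_congr rfl fun z _ => ?_
    rw [mul_inv_cancel_left₀ sqrt_two_ne]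
  rw [sectorOp_snd]
  have h1 : fermiHamiltonian hop U (sectorEmbed ψ) [] [x] = 0 := by
    simp [fermiHamiltonian, fermiNum, fermiCre_nil]
  have h2 : boseHamiltonian hop hb (sectorEmbed ψ) [] [x] =
      (hop : ℂ) * (-(hb / 2) * ∑ z ∈ nn, ψ.snd (x + z) + 2 * hb * ψ.snd x) := by
    simp only [boseHamiltonian, boseCre_one, boseAnn_nil, sectorEmbed]
    rw [hop_tsum x (fun y => ψ.snd y), site_tsum x (fun y => ψ.snd y)]
  have h3 : exchange κ v (sectorEmbed ψ) [] [x] = ∑' y : Site, (v.toFun (x - y) : ℂ) *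
        ∑ z ∈ closeSites, (Real.exp (-κ * siteNorm z) : ℂ) * ψ.fst (y + z, y) := by
    simp only [exchange, boseCre_one, hP, pairCre, fermiCre_nil, mul_zero, Finset.sum_const_zero,
      add_zero]
    rw [tsum_eq_single x]
    · simp
    · intro x' hx'
      simp only [if_neg fun h : x = x' => hx' h.symm, mul_zero, tsum_zero]
  simp only [hamiltonian, Pi.add_apply, h1, h2, h3]
  ring

theorem embed_ud (ψ : Sector) (x y : Site) :
    sectorEmbed ψ [(x, .up), (y, .down)] [] = -(Real.sqrt 2 : ℂ)⁻¹ * ψ.fst (x, y) := rfl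
theorem embed_du (ψ : Sector) (x y : Site) :
    sectorEmbed ψ [(y, .down), (x, .up)] [] = (Real.sqrt 2 : ℂ)⁻¹ * ψ.fst (x, y) := rfl
theorem embed_uu (ψ : Sector) (x y : Site) :
    sectorEmbed ψ [(x, .up), (y, .up)] [] = 0 := rfl
theorem embed_dd (ψ : Sector) (x y : Site) :
    sectorEmbed ψ [(x, .down), (y, .down)] [] = 0 := rfl
theorem embed_b (ψ : Sector) (x : Site) : sectorEmbed ψ [] [x] = ψ.snd x := rfl

theorem sum_spin (F : Spin → ℂ) : ∑ s, F s = F .up + F .down := by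
  change ∑ s ∈ ({.up, .down} : Finset Spin), F s = _
  rw [Finset.sum_pair (by decide)]

theorem fermiQuad_two (m m' p q : Mode) (Ψ : WaveFunction) (k : List Site) :
    fermiCre m (fermiAnn m' Ψ) [p, q] k =
      (if p = m then Ψ [m', q] k else 0) - if q = m then Ψ [m', p] k else 0 := by
  rw [fermiCre_two, fermiAnn_one, fermiAnn_one]
  split_ifs <;> field_simp [sqrt_two_ne] <;> ring

theorem neg_ite_zero (c : Prop) [Decidable c] (t : ℂ) :
    -(if c then t else 0) = if c then -t else 0 := by
  split_ifs <;> simp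

theorem exchange_tsum (w : Site → ℂ) (v : Coupling) (κ : ℝ) (a b : Site) (s : ℂ) :
    (∑' x : Site, ∑' y : Site, (v.toFun (x - y) : ℂ) * ∑ z ∈ closeSites,
      (Real.exp (-κ * siteNorm z) : ℂ) *
        (s * if b = y then (if a = y + z then w x else 0) else 0)) =
    s * ∑ z ∈ closeSites, (Real.exp (-κ * siteNorm z) : ℂ) *
      if a = b + z then ∑' x : Site, (v.toFun (x - b) : ℂ) * w x else 0 := by
  have h : ∀ x : Site, (∑' y : Site, (v.toFun (x - y) : ℂ) * ∑ z ∈ closeSites,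
      (Real.exp (-κ * siteNorm z) : ℂ) *
        (s * if b = y then (if a = y + z then w x else 0) else 0)) =
      ((v.toFun (x - b) : ℂ) * w x) * (s * ∑ z ∈ closeSites,
        (Real.exp (-κ * siteNorm z) : ℂ) * if a = b + z then 1 else 0) := by
    intro x
    rw [tsum_eq_single b]
    · rw [Finset.mul_sum, Finset.mul_sum, Finset.mul_sum]
      refine Finset.sum_congr rfl fun z _ => ?_
      rw [if_pos rfl]
      split_ifs
      · ring
      · simp
    · intro y hy
      simp only [if_neg fun h : b = y => hy h.symm, mul_zero, Finset.sum_const_zero]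
  simp only [h]
  rw [tsum_mul_right, Finset.mul_sum, Finset.mul_sum, Finset.mul_sum]
  refine Finset.sum_congr rfl fun z _ => ?_
  split_ifs
  · ring
  · simp

theorem ud_eq : (Spin.up = Spin.down) = False := by simp
theorem du_eq : (Spin.down = Spin.up) = False := by simp

theorem hamiltonian_ud (hop U hb κ : ℝ) (v : Coupling) (ψ : Sector) (a b : Site) :
    hamiltonian hop U hb κ v (sectorEmbed ψ) [(a, .up), (b, .down)] [] =
      -(Real.sqrt 2 : ℂ)⁻¹ * (sectorOp hop U hb κ v ψ).fst (a, b) := by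
  rw [sectorOp_fst]
  have h1 : fermiHamiltonian hop U (sectorEmbed ψ) [(a, .up), (b, .down)] [] =
      -(Real.sqrt 2 : ℂ)⁻¹ * ((hop : ℂ) * (-(1 / 2) * ∑ z ∈ nn, (ψ.fst (a + z, b) +
        ψ.fst (a, b + z)) + 4 * ψ.fst (a, b)) + U * (if a = b then ψ.fst (a, b) else 0)) := by
    have e1 := hop_tsum a (fun y => -(Real.sqrt 2 : ℂ)⁻¹ * ψ.fst (y, b))
    have e2 := hop_tsum b (fun y => -(Real.sqrt 2 : ℂ)⁻¹ * ψ.fst (a, y))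
    have e3 := site_tsum a (fun y => -(Real.sqrt 2 : ℂ)⁻¹ * ψ.fst (y, b))
    have e4 := site_tsum b (fun y => -(Real.sqrt 2 : ℂ)⁻¹ * ψ.fst (a, y))
    have e5 := site_tsum a (fun y => if b = y then -(Real.sqrt 2 : ℂ)⁻¹ * ψ.fst (y, y) else 0)
    simp only [fermiHamiltonian, fermiNum, fermiQuad_two, sum_spin, Prod.mk.injEq, ud_eq, du_eq,
      and_true, and_false, if_false, sub_zero, zero_sub, embed_ud, embed_du, embed_uu, embed_dd]
    simp only [neg_ite_zero, neg_mul] at e1 e2 e3 e4 e5 ⊢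
    rw [e1, e2, e3, e4, e5]
    simp only [Finset.sum_neg_distrib, Finset.sum_add_distrib, ← Finset.mul_sum]
    by_cases hab : a = b
    · subst hab; simp only [if_true]; ring
    · rw [if_neg hab, if_neg fun h => hab h.symm]; ring
  have h2 : boseHamiltonian hop hb (sectorEmbed ψ) [(a, .up), (b, .down)] [] = 0 := by
    simp [boseHamiltonian, boseCre_nil]
  have h3 : exchange κ v (sectorEmbed ψ) [(a, .up), (b, .down)] [] =
    -(Real.sqrt 2 : ℂ)⁻¹ * ∑ z ∈ closeSites, (Real.exp (-κ * siteNorm z) : ℂ) *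
          if a = b + z then ∑' w : Site, (v.toFun (w - b) : ℂ) * ψ.snd w else 0 := by
    simp only [exchange, boseCre_nil, pairCre, fermiCre_two, fermiCre_one, Prod.mk.injEq, ud_eq,
      du_eq, and_true, and_false, if_false, zero_sub, ite_self, boseAnn_nil, embed_b, zero_add]
    have e := exchange_tsum ψ.snd v κ a b (-(Real.sqrt 2 : ℂ)⁻¹)
    simp only [mul_neg, neg_mul] at e ⊢
    exact e
  simp only [hamiltonian, Pi.add_apply, h1, h2, h3]
  ring

theorem hamiltonian_du (hop U hb κ : ℝ) (v : Coupling) (ψ : Sector) (a b : Site) :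
    hamiltonian hop U hb κ v (sectorEmbed ψ) [(b, .down), (a, .up)] [] =
      (Real.sqrt 2 : ℂ)⁻¹ * (sectorOp hop U hb κ v ψ).fst (a, b) := by
  rw [sectorOp_fst]
  have h1 : fermiHamiltonian hop U (sectorEmbed ψ) [(b, .down), (a, .up)] [] =
      (Real.sqrt 2 : ℂ)⁻¹ * ((hop : ℂ) * (-(1 / 2) * ∑ z ∈ nn, (ψ.fst (a + z, b) +
        ψ.fst (a, b + z)) + 4 * ψ.fst (a, b)) + U * (if a = b then ψ.fst (a, b) else 0)) := by
    have e1 := hop_tsum a (fun y => (Real.sqrt 2 : ℂ)⁻¹ * ψ.fst (y, b))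
    have e2 := hop_tsum b (fun y => (Real.sqrt 2 : ℂ)⁻¹ * ψ.fst (a, y))
    have e3 := site_tsum a (fun y => (Real.sqrt 2 : ℂ)⁻¹ * ψ.fst (y, b))
    have e4 := site_tsum b (fun y => (Real.sqrt 2 : ℂ)⁻¹ * ψ.fst (a, y))
    have e5 := site_tsum a (fun y => if b = y then (Real.sqrt 2 : ℂ)⁻¹ * ψ.fst (y, y) else 0)
    simp only [fermiHamiltonian, fermiNum, fermiQuad_two, sum_spin, Prod.mk.injEq, ud_eq, du_eq,
      and_true, and_false, if_false, sub_zero, zero_sub, embed_ud, embed_du, embed_uu, embed_dd]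
    simp only [neg_ite_zero, neg_mul, neg_neg] at e1 e2 e3 e4 e5 ⊢
    rw [e1, e2, e3, e4, e5]
    simp only [Finset.sum_add_distrib, ← Finset.mul_sum]
    by_cases hab : a = b
    · subst hab; simp only [if_true]; ring
    · rw [if_neg hab, if_neg fun h => hab h.symm]; ring
  have h2 : boseHamiltonian hop hb (sectorEmbed ψ) [(b, .down), (a, .up)] [] = 0 := by
    simp [boseHamiltonian, boseCre_nil]
  have h3 : exchange κ v (sectorEmbed ψ) [(b, .down), (a, .up)] [] =
    (Real.sqrt 2 : ℂ)⁻¹ * ∑ z ∈ closeSites, (Real.exp (-κ * siteNorm z) : ℂ) *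
          if a = b + z then ∑' w : Site, (v.toFun (w - b) : ℂ) * ψ.snd w else 0 := by
    simp only [exchange, boseCre_nil, pairCre, fermiCre_two, fermiCre_one, Prod.mk.injEq, ud_eq,
      du_eq, and_true, and_false, if_false, sub_zero, ite_self, boseAnn_nil, embed_b, zero_add]
    have e := exchange_tsum ψ.snd v κ a b ((Real.sqrt 2 : ℂ)⁻¹)
    simp only [neg_mul] at e ⊢
    exact e
  simp only [hamiltonian, Pi.add_apply, h1, h2, h3]
  ring

theorem hamiltonian_uu (hop U hb κ : ℝ) (v : Coupling) (ψ : Sector) (a b : Site) :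
    hamiltonian hop U hb κ v (sectorEmbed ψ) [(a, .up), (b, .up)] [] = 0 := by
  have h1 : fermiHamiltonian hop U (sectorEmbed ψ) [(a, .up), (b, .up)] [] = 0 := by
    simp [fermiHamiltonian, fermiNum, fermiQuad_two, sum_spin, embed_uu]
  have h2 : boseHamiltonian hop hb (sectorEmbed ψ) [(a, .up), (b, .up)] [] = 0 := by
    simp [boseHamiltonian, boseCre_nil]
  have h3 : exchange κ v (sectorEmbed ψ) [(a, .up), (b, .up)] [] = 0 := by
    simp [exchange, boseCre_nil, pairCre, fermiCre_two]
  simp only [hamiltonian, Pi.add_apply, h1, h2, h3, add_zero]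

theorem hamiltonian_dd (hop U hb κ : ℝ) (v : Coupling) (ψ : Sector) (a b : Site) :
    hamiltonian hop U hb κ v (sectorEmbed ψ) [(a, .down), (b, .down)] [] = 0 := by
  have h1 : fermiHamiltonian hop U (sectorEmbed ψ) [(a, .down), (b, .down)] [] = 0 := by
    simp [fermiHamiltonian, fermiNum, fermiQuad_two, sum_spin, embed_dd]
  have h2 : boseHamiltonian hop hb (sectorEmbed ψ) [(a, .down), (b, .down)] [] = 0 := by
    simp [boseHamiltonian, boseCre_nil]
  have h3 : exchange κ v (sectorEmbed ψ) [(a, .down), (b, .down)] [] = 0 := by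
    simp [exchange, boseCre_nil, pairCre, fermiCre_two, fermiCre_one]
  simp only [hamiltonian, Pi.add_apply, h1, h2, h3, add_zero]

theorem hamiltonian_sectorEmbed (hop U hb κ : ℝ) (v : Coupling) (ψ : Sector) :
    hamiltonian hop U hb κ v (sectorEmbed ψ) = sectorEmbed (sectorOp hop U hb κ v ψ) := by
  funext l k
  by_cases h : (l.length : ℤ) + 2 * k.length = 2
  · match l, k, h with
    | [], [x], _ => exact hamiltonian_boson hop U hb κ v ψ x
    | [(a, .up), (b, .down)], [], _ => exact hamiltonian_ud hop U hb κ v ψ a b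
    | [(b, .down), (a, .up)], [], _ => exact hamiltonian_du hop U hb κ v ψ a b
    | [(a, .up), (b, .up)], [], _ => exact hamiltonian_uu hop U hb κ v ψ a b
    | [(a, .down), (b, .down)], [], _ => exact hamiltonian_dd hop U hb κ v ψ a b
    | [], [], h => simp at h
    | [_], k, h => simp at h; omega
    | _ :: _ :: _ :: _, k, h => simp at h; omega
    | [_, _], _ :: _, h => simp at h; omega
    | [], _ :: _ :: _, h => simp at h; omega
  · rw [(hasCharge_sectorEmbed ψ).hamiltonian hop U hb κ v l k h, hasCharge_sectorEmbed _ l k h]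
theorem sectorEmbed_injective : Function.Injective sectorEmbed := by
  intro ψ φ h
  have h1 : ψ.fst = φ.fst := by
    ext ⟨x, y⟩
    have := congrFun (congrFun h [(y, .down), (x, .up)]) []
    rw [embed_du, embed_du] at this
    exact mul_left_cancel₀ (inv_ne_zero sqrt_two_ne) this
  have h2 : ψ.snd = φ.snd := by
    ext x
    exact congrFun (congrFun h []) [x]
  exact WithLp.ofLp_injective 2 (Prod.ext h1 h2)

theorem pull_adjoint_neg {α : Type*} [DecidableEq α] {f g : α → α} (hf : Function.Injective f)
    (hg : Function.Injective g) (h : ∀ x, f (g x) = x) :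
    ContinuousLinearMap.adjoint (pull hf) = pull hg := by
  ext c x
  have := pull_adjoint_apply hf c (g x)
  rw [h] at this
  rw [this, pull_apply]

theorem adjoint_sum_up_down :
    ContinuousLinearMap.adjoint (∑ z ∈ nn, (pull (inj_up z) + pull (inj_down z))) =
      ∑ z ∈ nn, (pull (inj_up z) + pull (inj_down z)) := by
  rw [map_sum]
  refine Finset.sum_bij' (fun z _ => -z) (fun z _ => -z) nn_neg nn_neg (by simp) (by simp) ?_
  intro z _
  rw [map_add, pull_adjoint_neg (inj_up z) (inj_up (-z)) (by simp),
    pull_adjoint_neg (inj_down z) (inj_down (-z)) (by simp)]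

theorem adjoint_sum_shift :
    ContinuousLinearMap.adjoint (∑ z ∈ nn, shift z) = ∑ z ∈ nn, shift z := by
  rw [map_sum]
  refine Finset.sum_bij' (fun z _ => -z) (fun z _ => -z) nn_neg nn_neg (by simp) (by simp) ?_
  intro z _
  exact pull_adjoint_neg _ _ (by simp)

theorem adjoint_smul_real {E : Type*} [NormedAddCommGroup E] [InnerProductSpace ℂ E]
    [CompleteSpace E] (r : ℝ) {s : ℂ} (hs : (r : ℂ) = s) (T : E →L[ℂ] E)
    (hT : ContinuousLinearMap.adjoint T = T) :
    ContinuousLinearMap.adjoint (s • T) = s • T := by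
  rw [← hs, map_smulₛₗ, Complex.conj_ofReal, hT]

theorem adjoint_pairKinetic (hop U : ℝ) :
    ContinuousLinearMap.adjoint (pairKinetic hop U) = pairKinetic hop U := by
  have h1 : ContinuousLinearMap.adjoint diagOp = diagOp := by
    rw [diagOp, ContinuousLinearMap.adjoint_comp, ContinuousLinearMap.adjoint_adjoint]
  have h2 : ContinuousLinearMap.adjoint
      (ContinuousLinearMap.id ℂ (lp (fun _ : Site × Site => ℂ) 2)) = ContinuousLinearMap.id ℂ _ :=
    ContinuousLinearMap.adjoint_id
  rw [pairKinetic, map_add, adjoint_smul_real U rfl _ h1]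
  congr 1
  refine adjoint_smul_real hop rfl _ ?_
  rw [map_add, adjoint_smul_real 4 (by push_cast; rfl) _ h2,
    adjoint_smul_real (-(1 / 2)) (by push_cast; rfl) _ adjoint_sum_up_down]

theorem adjoint_boseKinetic (hop hb : ℝ) :
    ContinuousLinearMap.adjoint (boseKinetic hop hb) = boseKinetic hop hb := by
  have h2 : ContinuousLinearMap.adjoint
      (ContinuousLinearMap.id ℂ (lp (fun _ : Site => ℂ) 2)) = ContinuousLinearMap.id ℂ _ :=
    ContinuousLinearMap.adjoint_id
  rw [boseKinetic]
  refine adjoint_smul_real hop rfl _ ?_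
  rw [map_add, adjoint_smul_real (2 * hb) (by push_cast; rfl) _ h2,
    adjoint_smul_real (-(hb / 2)) (by push_cast; rfl) _ adjoint_sum_shift]

theorem isSelfAdjoint_sectorOp (hop U hb κ : ℝ) (v : Coupling) :
    IsSelfAdjoint (sectorOp hop U hb κ v) := by
  rw [ContinuousLinearMap.isSelfAdjoint_iff_isSymmetric]
  intro ψ φ
  change inner ℂ (sectorOp hop U hb κ v ψ) φ = inner ℂ ψ (sectorOp hop U hb κ v φ)
  have hf : ∀ χ : Sector, (sectorOp hop U hb κ v χ).fst = pairKinetic hop U χ.fst +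
    ContinuousLinearMap.adjoint (convOp v ∘L pairOp κ) χ.snd := fun _ => rfl
  have hs : ∀ χ : Sector, (sectorOp hop U hb κ v χ).snd = (convOp v ∘L pairOp κ) χ.fst +
    boseKinetic hop hb χ.snd := fun _ => rfl
  rw [WithLp.prod_inner_apply, WithLp.prod_inner_apply]
  change inner ℂ (sectorOp hop U hb κ v ψ).fst φ.fst + inner ℂ (sectorOp hop U hb κ v ψ).snd φ.snd =
    inner ℂ ψ.fst (sectorOp hop U hb κ v φ).fst + inner ℂ ψ.snd (sectorOp hop U hb κ v φ).snd
  rw [hf, hf, hs, hs, inner_add_left, inner_add_left, inner_add_right, inner_add_right,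
    ContinuousLinearMap.adjoint_inner_left, ContinuousLinearMap.adjoint_inner_right,
    ← ContinuousLinearMap.adjoint_inner_left (pairKinetic hop U), adjoint_pairKinetic,
    ← ContinuousLinearMap.adjoint_inner_left (boseKinetic hop hb), adjoint_boseKinetic]
  ring

/-- Exactly one bounded operator on the sector is the restriction of the full Hamiltonian. -/
theorem existsUnique_restriction (hop U hb κ : ℝ) (v : Coupling) :
    ∃! T : Sector →L[ℂ] Sector,
      ∀ ψ, hamiltonian hop U hb κ v (sectorEmbed ψ) = sectorEmbed (T ψ) := by
  refine ⟨sectorOp hop U hb κ v, hamiltonian_sectorEmbed hop U hb κ v, fun T hT => ?_⟩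
  ext1 ψ
  apply sectorEmbed_injective
  rw [← hT ψ, hamiltonian_sectorEmbed]

/-- The Hamiltonian `H^{(2,1)}`: the restriction of the full Hamiltonian to the sector of one
zero-spin fermion pair or one boson. -/
noncomputable def sectorHamiltonian (hop U hb κ : ℝ) (v : Coupling) : Sector →L[ℂ] Sector :=
  (existsUnique_restriction hop U hb κ v).choose

theorem sectorHamiltonian_eq_sectorOp (hop U hb κ : ℝ) (v : Coupling) :
    sectorHamiltonian hop U hb κ v = sectorOp hop U hb κ v :=
  (existsUnique_restriction hop U hb κ v).unique
    (existsUnique_restriction hop U hb κ v).choose_spec.1 (hamiltonian_sectorEmbed hop U hb κ v)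

theorem isSelfAdjoint_sectorHamiltonian (hop U hb κ : ℝ) (v : Coupling) :
    IsSelfAdjoint (sectorHamiltonian hop U hb κ v) := by
  rw [sectorHamiltonian_eq_sectorOp]
  exact isSelfAdjoint_sectorOp hop U hb κ v

/-! ### Spectral notions -/

/-- The bottom `inf σ(T)` of the spectrum of a bounded self-adjoint operator. -/
noncomputable def spectrumBottom {E : Type*} [NormedAddCommGroup E] [InnerProductSpace ℂ E]
    [CompleteSpace E] (T : E →L[ℂ] E) : ℝ :=
  sInf (spectrum ℝ T)

/-- The spectral subspace `Ran 1_K(T)` of a bounded self-adjoint operator `T` for a closed set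
`K ⊆ ℝ`: the vectors `ψ` with `f(T) ψ = 0` for every continuous `f` that vanishes on `K`, that is,
the vectors whose spectral measure with respect to `T` is carried by `K`. -/
noncomputable def spectralSubspace {E : Type*} [NormedAddCommGroup E] [InnerProductSpace ℂ E]
    [CompleteSpace E] (T : E →L[ℂ] E) (K : Set ℝ) : Submodule ℂ E where
  carrier := {ψ | ∀ f : ℝ → ℝ, Continuous f → (∀ x ∈ K, f x = 0) → cfc f T ψ = 0}
  zero_mem' := fun _ _ _ => map_zero _
  add_mem' := fun ha hb f hf h => by rw [map_add, ha f hf h, hb f hf h, add_zero]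
  smul_mem' := fun c ψ hψ f hf h => by rw [map_smul, hψ f hf h, smul_zero]

/-- The ground state energy `E₀ = inf σ(H^{(2,1)})`. -/
noncomputable def groundEnergy (hop U hb κ : ℝ) (v : Coupling) : ℝ :=
  spectrumBottom (sectorHamiltonian hop U hb κ v)

/-- The low-energy subspace `Ran 1_{[E₀, E₀(1 - ε)]}(H^{(2,1)})`. -/
noncomputable def lowEnergySpace (hop U hb κ : ℝ) (v : Coupling) (ε : ℝ) : Submodule ℂ Sector :=
  spectralSubspace (sectorHamiltonian hop U hb κ v)
    (Set.Icc (groundEnergy hop U hb κ v) (groundEnergy hop U hb κ v * (1 - ε)))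

/-- The norm-one `C¹` solutions of `i dψ/dt = H^{(2,1)} ψ` with values in the low-energy subspace. -/
def lowEnergySolutions (hop U hb κ : ℝ) (v : Coupling) (ε : ℝ) : Set (ℝ → Sector) :=
  {ψ | ContDiff ℝ 1 ψ ∧
    (∀ t, ψ t ∈ lowEnergySpace hop U hb κ v ε) ∧
    (∀ t, ‖ψ t‖ = 1) ∧
    ∀ t, Complex.I • deriv ψ t = sectorHamiltonian hop U hb κ v (ψ t)}

/-- `∑_{|x↑ - x↓| ≤ R} |𝔠(x↑, x↓)|²`. -/
noncomputable def pairWeight (R : ℝ) (c : lp (fun _ : Site × Site => ℂ) 2) : ℝ :=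
  ∑' p : {p : Site × Site // siteNorm (p.1 - p.2) ≤ R}, ‖c p.1‖ ^ 2

end BipolaronElectron

open BipolaronElectron

/-! The weight of the pair within distance `R` is a constant of motion at low energy. Hopping and
repulsion are nonnegative, so only the exchange term, bounded by a multiple of the product of the
norms of both components, can make the energy negative. Hence a low-energy vector without boson
component vanishes: the low-energy space `S` embeds, equivariantly under translations, into `ℓ²(ℤ²)`
through `ψ ↦ ψ.snd`. Translation-invariant operators on `ℓ²(ℤ²)` are convolutions and commute with
one another, and this commutativity passes to `S` (`mul_comm_of_equivariant`). Since the distance of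
the two fermions is translation invariant, the compressions to `S` of the Hamiltonian and of the
projection onto distances at most `R` commute, and the expectation of the latter is conserved
(`inner_apply_const`, `pairWeight_const`).

The first claim then only needs a radius that works at time zero, which square summability gives.

For the second claim, write `ψ = H φ`, where `φ` is bounded because the energy is at most `-δ < 0`
on `S`. Repulsion and exchange live at pair distances at most one, so beyond that distance the pair
wave function is `hop` times a bounded expression (`norm_far_le`). This is small relative to the
whole pair component, whose norm is bounded below by `mul_norm_le_mul_norm_fst`. A trial state keeps
`δ` away from zero as `hop → 0` (`exists_groundEnergy_le`); if the exchange operator vanishes, there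
is no negative energy at all. -/

namespace BipolaronElectron

/-! ### Spectral subspaces via the continuous functional calculus -/

section Spectral

variable {E : Type*} [NormedAddCommGroup E] [InnerProductSpace ℂ E] [CompleteSpace E]

/-- Closedness makes the subspace complete, so that its inclusion has an adjoint and operators can
be compressed to it. -/
theorem isClosed_spectralSubspace (T : E →L[ℂ] E) (K : Set ℝ) :
    IsClosed (spectralSubspace T K : Set E) := by
  have : (spectralSubspace T K : Set E) =
      ⋂ (f : ℝ → ℝ) (_ : Continuous f) (_ : ∀ x ∈ K, f x = 0), {ψ | cfc f T ψ = 0} := by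
    ext ψ
    simp [spectralSubspace]
  rw [this]
  exact isClosed_iInter fun f => isClosed_iInter fun _ => isClosed_iInter fun _ =>
    isClosed_eq (cfc f T).continuous continuous_const

/-- What commutes with `T` commutes with each `cfc f T`. This is applied to the translations and to
the Hamiltonian itself. -/
theorem map_mem_spectralSubspace {T A : E →L[ℂ] E} (hT : IsSelfAdjoint T) (h : Commute T A)
    {K : Set ℝ} {ψ : E} (hψ : ψ ∈ spectralSubspace T K) : A ψ ∈ spectralSubspace T K := by
  intro f hf hK
  have hc : Commute (cfc f T) A := h.cfc (by rwa [hT.star_eq]) f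
  have := DFunLike.congr_fun hc.eq ψ
  rw [mul_apply_eq_comp, mul_apply_eq_comp, hψ f hf hK, map_zero] at this
  exact this

/-- Continuous functions that agree on `K` act in the same way on the spectral subspace of `K`. -/
theorem cfc_congr_of_mem_spectralSubspace {T : E →L[ℂ] E} {K : Set ℝ} {ψ : E}
    (hψ : ψ ∈ spectralSubspace T K) {f g : ℝ → ℝ} (hf : Continuous f) (hg : Continuous g)
    (h : Set.EqOn f g K) : cfc f T ψ = cfc g T ψ := by
  have := hψ (fun x => f x - g x) (hf.sub hg) fun x hx => sub_eq_zero.2 (h hx)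
  rw [cfc_sub f g T hf.continuousOn hg.continuousOn, sub_apply] at this
  exact sub_eq_zero.1 this

/-- On the interval, `m - x` agrees with its positive part, whose functional calculus is a positive
operator. -/
theorem re_inner_le_of_mem_spectralSubspace {T : E →L[ℂ] E} (hT : IsSelfAdjoint T) {a m : ℝ}
    {ψ : E} (hψ : ψ ∈ spectralSubspace T (Set.Icc a m)) :
    RCLike.re (inner ℂ ψ (T ψ)) ≤ m * ‖ψ‖ ^ 2 := by
  have h1 : cfc (fun x : ℝ => max (m - x) 0) T ψ = cfc (fun x : ℝ => m - x) T ψ :=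
    cfc_congr_of_mem_spectralSubspace hψ (by fun_prop) (by fun_prop)
      fun x hx => max_eq_left (sub_nonneg.2 hx.2)
  have h2 : cfc (fun x : ℝ => m - x) T = algebraMap ℝ _ m - T := by
    rw [cfc_sub (fun _ => m) (fun x => x) T (by fun_prop) (by fun_prop), cfc_const m T,
      cfc_id' ℝ T]
  have h3 : 0 ≤ cfc (fun x : ℝ => max (m - x) 0) T := cfc_nonneg fun x _ => le_max_right _ _
  have h4 := ((ContinuousLinearMap.nonneg_iff_isPositive _).1 h3).re_inner_nonneg_right ψ
  rw [h1, h2, sub_apply, inner_sub_right, map_sub, Algebra.algebraMap_eq_smul_one,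
    _root_.smul_apply, one_apply_eq_self, inner_smul_right_eq_smul, RCLike.smul_re,
    inner_self_eq_norm_sq] at h4
  linarith

theorem spectrumBottom_mul_le {T : E →L[ℂ] E} (hT : IsSelfAdjoint T) (ψ : E) :
    spectrumBottom T * ‖ψ‖ ^ 2 ≤ RCLike.re (inner ℂ ψ (T ψ)) := by
  have h : algebraMap ℝ _ (spectrumBottom T) ≤ T := by
    rw [algebraMap_le_iff_le_spectrum]
    intro x hx
    exact csInf_le (spectrum.isCompact T).bddBelow hx
  have h4 := ((ContinuousLinearMap.nonneg_iff_isPositive _).1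
    (sub_nonneg.2 h)).re_inner_nonneg_right ψ
  rw [sub_apply, inner_sub_right, map_sub, Algebra.algebraMap_eq_smul_one,
    _root_.smul_apply, one_apply_eq_self, inner_smul_right_eq_smul, RCLike.smul_re,
    inner_self_eq_norm_sq] at h4
  linarith

/-- The truncated inverse `(min x (-δ))⁻¹` is continuous on the whole line, bounded by `δ⁻¹`, and
equal to `x⁻¹` on the interval, so it inverts `T` on the spectral subspace even if `0` lies in the
spectrum. -/
theorem exists_apply_eq_of_mem_spectralSubspace {T : E →L[ℂ] E} (hT : IsSelfAdjoint T) {a δ : ℝ}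
    (hδ : 0 < δ) {ψ : E} (hψ : ψ ∈ spectralSubspace T (Set.Icc a (-δ))) :
    ∃ φ, T φ = ψ ∧ ‖φ‖ ≤ δ⁻¹ * ‖ψ‖ := by
  have hne : ∀ x : ℝ, min x (-δ) ≠ 0 := fun x =>
    ((min_le_right x (-δ)).trans_lt (neg_lt_zero.2 hδ)).ne
  have hc : Continuous fun x : ℝ => (min x (-δ))⁻¹ := Continuous.inv₀ (by fun_prop) hne
  refine ⟨cfc (fun x : ℝ => (min x (-δ))⁻¹) T ψ, ?_, ?_⟩
  · have h1 : cfc (fun x : ℝ => x * (min x (-δ))⁻¹) T ψ = cfc (fun _ : ℝ => (1 : ℝ)) T ψ := by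
      refine cfc_congr_of_mem_spectralSubspace hψ (by fun_prop) (by fun_prop) fun x hx => ?_
      have := hne x
      rw [min_eq_left hx.2] at this
      simp only [min_eq_left hx.2]
      exact mul_inv_cancel₀ this
    rw [cfc_mul (fun x => x) _ T (by fun_prop) hc.continuousOn, cfc_id' ℝ T,
      cfc_const_one ℝ T] at h1
    exact h1
  · refine ContinuousLinearMap.le_of_opNorm_le _ (norm_cfc_le (by positivity) fun x _ => ?_) ψ
    rw [norm_inv, Real.norm_eq_abs]
    have := min_le_right x (-δ)
    rw [abs_of_neg (by linarith)]
    exact inv_anti₀ hδ (by linarith)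

end Spectral

/-! ### Commuting translation-invariant operators and conserved expectations -/

section Commutant

/-- Bounded operators on `ℓ²(ℤ²)` that commute with translations are convolutions, hence commute
with each other. -/
theorem mul_comm_of_commute_shift {S T : lp (fun _ : Site => ℂ) 2 →L[ℂ] lp (fun _ : Site => ℂ) 2}
    (hS : ∀ a, Commute S (shift a)) (hT : ∀ a, Commute T (shift a)) : S * T = T * S := by
  have shift_single : ∀ a x : Site, shift a (lp.single 2 x (1 : ℂ)) = lp.single 2 (x - a) 1 := by
    intro a x
    ext y
    change (lp.single 2 x (1 : ℂ) : lp (fun _ : Site => ℂ) 2) (y + a) = _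
    simp [Pi.single_apply, eq_sub_iff_add_eq]
  -- The matrix of a translation-invariant operator depends only on `x - y`.
  have kernel : ∀ R : lp (fun _ : Site => ℂ) 2 →L[ℂ] lp (fun _ : Site => ℂ) 2,
      (∀ a, Commute R (shift a)) → ∀ x y : Site,
      R (lp.single 2 y (1 : ℂ)) x = R (lp.single 2 0 (1 : ℂ)) (x - y) := by
    intro R hR x y
    have h := DFunLike.congr_fun (hR (-y)).eq (lp.single 2 0 (1 : ℂ))
    rw [mul_apply_eq_comp, mul_apply_eq_comp, shift_single, zero_sub,
      neg_neg] at h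
    rw [h, sub_eq_add_neg]
    rfl
  have conv : ∀ R : lp (fun _ : Site => ℂ) 2 →L[ℂ] lp (fun _ : Site => ℂ) 2,
      (∀ a, Commute R (shift a)) → ∀ (f : lp (fun _ : Site => ℂ) 2) (x : Site),
      R f x = ∑' y, R (lp.single 2 0 (1 : ℂ)) (x - y) * f y := by
    intro R hR f x
    -- Pairing `f` with `R* e_x` yields the convolution sum as an inner product, so convergence
    -- needs no separate argument.
    have h := (lp.hasSum_inner (𝕜 := ℂ)
      (ContinuousLinearMap.adjoint R (lp.single 2 x (1 : ℂ))) f).tsum_eq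
    rw [ContinuousLinearMap.adjoint_inner_left, ← apply_eq_inner] at h
    rw [← h]
    refine tsum_congr fun y => ?_
    have h2 : (ContinuousLinearMap.adjoint R (lp.single 2 x (1 : ℂ))) y =
        starRingEnd ℂ (R (lp.single 2 y (1 : ℂ)) x) := by
      rw [apply_eq_inner, ContinuousLinearMap.adjoint_inner_right, apply_eq_inner (R _) x,
        inner_conj_symm]
    rw [← kernel R hR, h2]
    simp [mul_comm]
  -- The substitution `z ↦ (x - y) - z` exchanges the two factors of a convolution.
  have hST : ∀ (x y : Site), (S * T) (lp.single 2 y (1 : ℂ)) x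
      = (T * S) (lp.single 2 y (1 : ℂ)) x := by
    intro x y
    rw [kernel _ (fun a => (hS a).mul_left (hT a)), kernel _ (fun a => (hT a).mul_left (hS a)),
      mul_apply_eq_comp, mul_apply_eq_comp, conv S hS, conv T hT,
      ← (Equiv.subLeft (x - y)).tsum_eq]
    refine tsum_congr fun z => ?_
    simp [mul_comm]
  ext f x
  rw [conv (S * T) (fun a => (hS a).mul_left (hT a)), conv (T * S) (fun a => (hT a).mul_left (hS a))]
  simp only [hST]

theorem adjoint_shift (a : Site) : ContinuousLinearMap.adjoint (shift a) = shift (-a) :=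
  pull_adjoint_neg _ _ (by simp)

variable {E : Type*} [NormedAddCommGroup E] [InnerProductSpace ℂ E]

theorem eq_of_comp_eq_of_forall_eq_zero {F G : Type*} [NormedAddCommGroup F]
    [InnerProductSpace ℂ F] [NormedAddCommGroup G] [InnerProductSpace ℂ G] {b : E →L[ℂ] F}
    (hb : ∀ ψ, b ψ = 0 → ψ = 0) {Z Z' : G →L[ℂ] E} (h : b ∘L Z = b ∘L Z') : Z = Z' := by
  ext1 x
  refine sub_eq_zero.1 (hb _ ?_)
  rw [map_sub, sub_eq_zero]
  exact DFunLike.congr_fun h x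

variable [CompleteSpace E]

/-- The compression of an operator to a closed subspace. -/
noncomputable def compression (S : Submodule ℂ E) [CompleteSpace S] (X : E →L[ℂ] E) :
    S →L[ℂ] S :=
  ContinuousLinearMap.adjoint S.subtypeL ∘L X ∘L S.subtypeL

theorem compression_apply (S : Submodule ℂ E) [CompleteSpace S] (X : E →L[ℂ] E) (ψ : S) :
    compression S X ψ = ContinuousLinearMap.adjoint S.subtypeL (X ψ) := rfl

theorem subtypeL_adjoint_apply (S : Submodule ℂ E) [CompleteSpace S] (ψ : S) :
    ContinuousLinearMap.adjoint S.subtypeL (ψ : E) = ψ := by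
  rw [Submodule.adjoint_subtypeL, Submodule.orthogonalProjectionOnto_mem_subspace_eq_self]

theorem coe_compression_of_mem (S : Submodule ℂ E) [CompleteSpace S] {X : E →L[ℂ] E}
    {ψ : S} (h : X ψ ∈ S) : (compression S X ψ : E) = X ψ := by
  rw [compression_apply]
  exact congrArg Subtype.val (subtypeL_adjoint_apply S ⟨_, h⟩)

/-- A Hilbert space with a unitary action of the translations that embeds equivariantly into
`ℓ²(ℤ²)` carries a commutative algebra of translation invariant operators. -/
theorem mul_comm_of_equivariant {τ : Site → E →L[ℂ] E}
    (hτ : ∀ a, ContinuousLinearMap.adjoint (τ a) = τ (-a))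
    {b : E →L[ℂ] lp (fun _ : Site => ℂ) 2} (hb : ∀ a, b ∘L τ a = shift a ∘L b)
    (hb0 : ∀ ψ, b ψ = 0 → ψ = 0) {X Y : E →L[ℂ] E} (hX : ∀ a, Commute X (τ a))
    (hY : ∀ a, Commute Y (τ a)) : X * Y = Y * X := by
  have hb' : ∀ a, τ a ∘L ContinuousLinearMap.adjoint b =
      ContinuousLinearMap.adjoint b ∘L shift a := by
    intro a
    have := congrArg ContinuousLinearMap.adjoint (hb (-a))
    rw [ContinuousLinearMap.adjoint_comp, ContinuousLinearMap.adjoint_comp, hτ, adjoint_shift,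
      neg_neg] at this
    exact this
  -- Conjugation by `b` carries invariant operators to the commutative algebra on `ℓ²(ℤ²)`. It is
  -- not multiplicative, since `b` need not be isometric; a factor `M = b* b` remains between
  -- products.
  have hG : ∀ Z : E →L[ℂ] E, (∀ a, Commute Z (τ a)) →
      ∀ a, Commute (b ∘L Z ∘L ContinuousLinearMap.adjoint b) (shift a) := by
    intro Z hZ a
    change (b ∘L Z ∘L ContinuousLinearMap.adjoint b) ∘L shift a =
      shift a ∘L (b ∘L Z ∘L ContinuousLinearMap.adjoint b)
    have h := (hZ a).eq
    change Z ∘L τ a = τ a ∘L Z at h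
    calc _ = b ∘L Z ∘L (ContinuousLinearMap.adjoint b ∘L shift a) := rfl
      _ = b ∘L (Z ∘L τ a) ∘L ContinuousLinearMap.adjoint b := by rw [← hb']; rfl
      _ = (b ∘L τ a) ∘L Z ∘L ContinuousLinearMap.adjoint b := by rw [h]; rfl
      _ = _ := by rw [hb]; rfl
  -- Injectivity of `b` cancels it on the left; passing to adjoints then cancels `b*` on the right.
  have cancel : ∀ Z Z' : E →L[ℂ] E,
      b ∘L Z ∘L ContinuousLinearMap.adjoint b = b ∘L Z' ∘L ContinuousLinearMap.adjoint b →
      Z = Z' := by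
    intro Z Z' h
    have h1 := congrArg ContinuousLinearMap.adjoint (eq_of_comp_eq_of_forall_eq_zero hb0 h)
    rw [ContinuousLinearMap.adjoint_comp, ContinuousLinearMap.adjoint_comp,
      ContinuousLinearMap.adjoint_adjoint] at h1
    exact ContinuousLinearMap.adjoint.injective (eq_of_comp_eq_of_forall_eq_zero hb0 h1)
  set M : E →L[ℂ] E := ContinuousLinearMap.adjoint b ∘L b with hMdef
  have key : ∀ Z Z' : E →L[ℂ] E, (∀ a, Commute Z (τ a)) → (∀ a, Commute Z' (τ a)) →
      Z * M * Z' = Z' * M * Z := by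
    intro Z Z' hZ hZ'
    apply cancel
    have h := mul_comm_of_commute_shift (hG Z hZ) (hG Z' hZ')
    rw [ContinuousLinearMap.mul_def, ContinuousLinearMap.mul_def] at h
    rw [ContinuousLinearMap.mul_def, ContinuousLinearMap.mul_def, ContinuousLinearMap.mul_def,
      ContinuousLinearMap.mul_def, hMdef]
    exact h
  -- Taking one operator to be `1` shows that `M` commutes with `X` and `Y`. Thus `M X Y = X M Y = Y
  -- M X = M Y X`, and `M` is removed by injectivity.
  have hXM := key 1 X (fun a => Commute.one_left _) hX
  have hXY := key X Y hX hY
  have hYM := key 1 Y (fun a => Commute.one_left _) hY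
  rw [one_mul, mul_one] at hXM hYM
  have hM : M ∘L (X * Y) = M ∘L (Y * X) := by
    rw [← ContinuousLinearMap.mul_def, ← ContinuousLinearMap.mul_def, ← mul_assoc, ← mul_assoc,
      hXM, hXY, hYM]
  -- `M` is injective because `⟨ψ, M ψ⟩ = ‖b ψ‖²`.
  refine eq_of_comp_eq_of_forall_eq_zero (b := M) (fun ψ h => hb0 ψ ?_) hM
  rw [← inner_self_eq_zero (𝕜 := ℂ), ← ContinuousLinearMap.adjoint_inner_right]
  rw [← ContinuousLinearMap.comp_apply, ← hMdef, h, inner_zero_right]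

/-- Injectivity of `β` is needed only on `S`, and neither `X` nor `Y` has to preserve `S`.
Invariance of `S` under the translations makes the compressions translation invariant. -/
theorem compression_comm (S : Submodule ℂ E) [CompleteSpace S] (τ : Site → E →L[ℂ] E)
    (hτ : ∀ a, ContinuousLinearMap.adjoint (τ a) = τ (-a)) (hτS : ∀ a, ∀ ψ ∈ S, τ a ψ ∈ S)
    (β : E →L[ℂ] lp (fun _ : Site => ℂ) 2) (hβ : ∀ a, β ∘L τ a = shift a ∘L β)
    (hβS : ∀ ψ ∈ S, β ψ = 0 → ψ = 0) {X Y : E →L[ℂ] E} (hX : ∀ a, Commute X (τ a))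
    (hY : ∀ a, Commute Y (τ a)) :
    compression S X * compression S Y = compression S Y * compression S X := by
  have ht : ∀ a (ψ : S), (compression S (τ a) ψ : E) = τ a ψ := fun a ψ =>
    coe_compression_of_mem S (hτS a ψ ψ.2)
  have htadj : ∀ a, ContinuousLinearMap.adjoint (compression S (τ a)) =
      compression S (τ (-a)) := by
    intro a
    simp only [compression, ContinuousLinearMap.adjoint_comp,
      ContinuousLinearMap.adjoint_adjoint, hτ]
    rfl
  have hcomm : ∀ Z : E →L[ℂ] E, (∀ a, Commute Z (τ a)) →
      ∀ a, Commute (compression S Z) (compression S (τ a)) := by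
    intro Z hZ a
    -- The adjoint of the invariance of `S` under `τ (-a)`: the projection onto `S` intertwines the
    -- translations.
    have h1 : ContinuousLinearMap.adjoint S.subtypeL ∘L τ a =
        compression S (τ a) ∘L ContinuousLinearMap.adjoint S.subtypeL := by
      have : τ (-a) ∘L S.subtypeL = S.subtypeL ∘L compression S (τ (-a)) := by
        ext1 ψ; exact (ht (-a) ψ).symm
      have := congrArg ContinuousLinearMap.adjoint this
      rw [ContinuousLinearMap.adjoint_comp, ContinuousLinearMap.adjoint_comp, htadj, hτ,
        neg_neg] at this
      exact this
    change compression S Z * compression S (τ a) = compression S (τ a) * compression S Z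
    ext1 ψ
    rw [mul_apply_eq_comp, mul_apply_eq_comp, compression_apply, ht,
      compression_apply S Z]
    have h2 := DFunLike.congr_fun (hZ a).eq (ψ : E)
    rw [mul_apply_eq_comp, mul_apply_eq_comp] at h2
    rw [h2]
    exact DFunLike.congr_fun h1 (Z ψ)
  refine mul_comm_of_equivariant (τ := fun a => compression S (τ a)) (b := β ∘L S.subtypeL)
    htadj (fun a => ?_) (fun ψ h => Subtype.ext (hβS ψ ψ.2 h)) (hcomm X hX) (hcomm Y hY)
  ext1 ψ
  have := DFunLike.congr_fun (hβ a) (ψ : E)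
  rw [ContinuousLinearMap.comp_apply, ContinuousLinearMap.comp_apply, Submodule.subtypeL_apply, ht]
  exact this

/-- The expectation of a translation invariant observable is conserved. -/
theorem inner_apply_const (S : Submodule ℂ E) (hS : IsClosed (S : Set E)) (τ : Site → E →L[ℂ] E)
    (hτ : ∀ a, ContinuousLinearMap.adjoint (τ a) = τ (-a)) (hτS : ∀ a, ∀ ψ ∈ S, τ a ψ ∈ S)
    (β : E →L[ℂ] lp (fun _ : Site => ℂ) 2) (hβ : ∀ a, β ∘L τ a = shift a ∘L β)
    (hβS : ∀ ψ ∈ S, β ψ = 0 → ψ = 0) {H Q : E →L[ℂ] E} (hH : ∀ a, Commute H (τ a))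
    (hQ : ∀ a, Commute Q (τ a)) (hHsa : IsSelfAdjoint H) (hHS : ∀ ψ ∈ S, H ψ ∈ S)
    {ψ : ℝ → E} (hd : Differentiable ℝ ψ) (hψ : ∀ t, ψ t ∈ S)
    (hode : ∀ t, Complex.I • deriv ψ t = H (ψ t)) (t s : ℝ) :
    inner ℂ (ψ t) (Q (ψ t)) = inner ℂ (ψ s) (Q (ψ s)) := by
  have : CompleteSpace S := hS.completeSpace_coe
  have hcomm := compression_comm S τ hτ hτS β hβ hβS hH hQ
  -- Although `Q φ` may leave `S`, the vectors `φ` and `H φ` lie in `S`, so commuting compressions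
  -- suffice for the commutator of `H` and `Q` to have zero expectation in `φ`.
  have key : ∀ φ ∈ S, inner ℂ (H φ) (Q φ) = inner ℂ φ (Q (H φ)) := by
    intro φ hφ
    have h := congrArg (inner ℂ (⟨φ, hφ⟩ : S)) (DFunLike.congr_fun hcomm ⟨φ, hφ⟩)
    rw [mul_apply_eq_comp, mul_apply_eq_comp,
      compression_apply S H, compression_apply S Q (compression S H _),
      ContinuousLinearMap.adjoint_inner_right, ContinuousLinearMap.adjoint_inner_right,
      coe_compression_of_mem S (X := H) (ψ := ⟨φ, hφ⟩) (hHS φ hφ)] at h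
    have h2 : inner ℂ φ (H (compression S Q ⟨φ, hφ⟩ : E)) = inner ℂ (H φ) (Q φ) := by
      rw [← ContinuousLinearMap.adjoint_inner_left, hHsa.adjoint_eq]
      have := ContinuousLinearMap.adjoint_inner_right S.subtypeL ⟨H φ, hHS φ hφ⟩ (Q φ)
      exact this
    exact h2.symm.trans h
  have hderiv : ∀ t, deriv ψ t = -Complex.I • H (ψ t) := by
    intro t
    rw [← hode, smul_smul]
    simp
  have hD : ∀ t, HasDerivAt (fun t => inner ℂ (ψ t) (Q (ψ t))) 0 t := by
    intro t
    have h1 := (hd t).hasDerivAt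
    have h2 : HasDerivAt (fun t => Q (ψ t)) (Q (deriv ψ t)) t :=
      (Q.restrictScalars ℝ).hasFDerivAt.comp_hasDerivAt t h1
    have h3 := h1.inner ℂ h2
    have h4 : inner ℂ (ψ t) (Q (deriv ψ t)) + inner ℂ (deriv ψ t) (Q (ψ t)) = 0 := by
      rw [hderiv, map_smul, inner_smul_right, inner_smul_left, key _ (hψ t)]
      simp
    rwa [h4] at h3
  exact is_const_of_deriv_eq_zero (fun t => (hD t).differentiableAt) (fun t => (hD t).deriv) t s

end Commutant

/-! ### Translation invariance of the Hamiltonian -/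

section Translations

theorem inj_both (a : Site) :
    Function.Injective (fun p : Site × Site => (p.1 + a, p.2 + a)) := by
  rintro ⟨x, y⟩ ⟨z, w⟩ h; simpa using h

/-- Simultaneous translation of all particles. -/
noncomputable def translation (a : Site) : Sector →L[ℂ] Sector :=
  (WithLp.prodContinuousLinearEquiv 2 ℂ _ _).symm.toContinuousLinearMap ∘L
    ((pull (inj_both a) ∘L WithLp.fstL 2 ℂ _ _).prod (shift a ∘L WithLp.sndL 2 ℂ _ _))

theorem translation_fst (a : Site) (ψ : Sector) :
    (translation a ψ).fst = pull (inj_both a) ψ.fst := rfl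

theorem translation_snd (a : Site) (ψ : Sector) : (translation a ψ).snd = shift a ψ.snd := rfl

theorem sector_inner (ψ φ : Sector) :
    inner ℂ ψ φ = inner ℂ ψ.fst φ.fst + inner ℂ ψ.snd φ.snd := WithLp.prod_inner_apply ψ φ

theorem sector_ext {ψ φ : Sector} (h1 : ψ.fst = φ.fst) (h2 : ψ.snd = φ.snd) : ψ = φ :=
  WithLp.ofLp_injective 2 (Prod.ext h1 h2)

theorem adjoint_translation (a : Site) :
    ContinuousLinearMap.adjoint (translation a) = translation (-a) := by
  symm
  rw [ContinuousLinearMap.eq_adjoint_iff]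
  intro ψ φ
  rw [sector_inner, sector_inner, translation_fst, translation_fst, translation_snd,
    translation_snd, ← adjoint_shift, ContinuousLinearMap.adjoint_inner_left,
    ← pull_adjoint_neg (inj_both a) (inj_both (-a)) (by simp),
    ContinuousLinearMap.adjoint_inner_left]

theorem commute_sectorOp_translation (hop U hb κ : ℝ) (v : Coupling) (a : Site) :
    Commute (sectorOp hop U hb κ v) (translation a) := by
  change _ * _ = _ * _
  ext1 ψ
  rw [mul_apply_eq_comp, mul_apply_eq_comp]
  have hc : ∀ x y : Site, (translation a ψ).fst (x, y) = ψ.fst (x + a, y + a) := fun _ _ => rfl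
  have hd : ∀ x : Site, (translation a ψ).snd x = ψ.snd (x + a) := fun _ => rfl
  apply sector_ext
  · ext ⟨x, y⟩
    rw [translation_fst, pull_apply, sectorOp_fst, sectorOp_fst]
    have h1 : (∑' w : Site, (v.toFun (w - (y + a)) : ℂ) * ψ.snd w) =
        ∑' w : Site, (v.toFun (w - y) : ℂ) * (translation a ψ).snd w := by
      rw [← (Equiv.addRight a).tsum_eq]
      refine tsum_congr fun w => ?_
      rw [hd, Equiv.coe_addRight, add_sub_add_right_eq_sub]
    simp only [h1, hc, add_left_inj, add_right_comm _ a]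
  · ext x
    change (sectorOp hop U hb κ v (translation a ψ)).snd x =
      (sectorOp hop U hb κ v ψ).snd (x + a)
    rw [sectorOp_snd, sectorOp_snd, ← (Equiv.addRight a).tsum_eq (fun y : Site =>
      (v.toFun (x + a - y) : ℂ) * ∑ z ∈ WaveFunction.closeSites,
        (Real.exp (-κ * siteNorm z) : ℂ) * ψ.fst (y + z, y))]
    simp only [hc, hd, Equiv.coe_addRight, add_sub_add_right_eq_sub, add_right_comm _ a]

end Translations

/-! ### Pair weight at bounded distance -/

section Localization

/-- Restriction of the pair wave function to distances at most `R`. -/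
noncomputable def nearRestrict (R : ℝ) : Sector →L[ℂ]
    lp (fun _ : {p : Site × Site // siteNorm (p.1 - p.2) ≤ R} => ℂ) 2 :=
  pull Subtype.val_injective ∘L WithLp.fstL 2 ℂ _ _

theorem lp_norm_sq {α : Type*} (c : lp (fun _ : α => ℂ) 2) : ‖c‖ ^ 2 = ∑' x, ‖c x‖ ^ 2 := by
  have := lp.norm_rpow_eq_tsum (p := 2) (by norm_num) c
  simpa using this

theorem lp_summable_sq {α : Type*} (c : lp (fun _ : α => ℂ) 2) :
    Summable fun x => ‖c x‖ ^ 2 := by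
  have := (memℓp_gen_iff (p := 2) (by norm_num)).1 (lp.memℓp c)
  simpa using this

theorem norm_nearRestrict_sq (R : ℝ) (ψ : Sector) :
    ‖nearRestrict R ψ‖ ^ 2 = pairWeight R ψ.fst := lp_norm_sq _

theorem pairWeight_add_norm_pull_sq (R : ℝ) (c : lp (fun _ : Site × Site => ℂ) 2) :
    pairWeight R c + ‖pull (Subtype.val_injective
      (p := fun p : Site × Site => ¬ siteNorm (p.1 - p.2) ≤ R)) c‖ ^ 2 = ‖c‖ ^ 2 := by
  rw [lp_norm_sq, lp_norm_sq]
  exact (lp_summable_sq c).tsum_subtype_add_tsum_subtype_compl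
    {p : Site × Site | siteNorm (p.1 - p.2) ≤ R}

/-- Simultaneous translation preserves `x - y`, hence acts on the set of pairs at distance at most
`R`. -/
theorem commute_near_translation (R : ℝ) (a : Site) :
    Commute (ContinuousLinearMap.adjoint (nearRestrict R) ∘L nearRestrict R) (translation a) := by
  have hinj : ∀ a : Site, Function.Injective
      (fun p : {p : Site × Site // siteNorm (p.1 - p.2) ≤ R} =>
        (⟨(p.1.1 + a, p.1.2 + a), by simpa using p.2⟩ :
          {p : Site × Site // siteNorm (p.1 - p.2) ≤ R})) := by
    rintro a ⟨p, hp⟩ ⟨q, hq⟩ h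
    exact Subtype.ext (inj_both a (congrArg Subtype.val h))
  have h1 : ∀ a, nearRestrict R ∘L translation a = pull (hinj a) ∘L nearRestrict R := fun _ => rfl
  have h2 : translation a ∘L ContinuousLinearMap.adjoint (nearRestrict R) =
      ContinuousLinearMap.adjoint (nearRestrict R) ∘L pull (hinj a) := by
    have h := congrArg ContinuousLinearMap.adjoint (h1 (-a))
    rw [ContinuousLinearMap.adjoint_comp, ContinuousLinearMap.adjoint_comp, adjoint_translation,
      neg_neg, pull_adjoint_neg (hinj (-a)) (hinj a) (by rintro ⟨p, hp⟩; simp)] at h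
    exact h
  change (_ ∘L _) ∘L _ = _ ∘L (_ ∘L _)
  rw [ContinuousLinearMap.comp_assoc, h1, ← ContinuousLinearMap.comp_assoc, ← h2]
  rfl

theorem siteNorm_nonneg (z : Site) : 0 ≤ siteNorm z := Real.sqrt_nonneg _

theorem exists_lt_pairWeight (c : lp (fun _ : Site × Site => ℂ) 2) {r : ℝ} (hr : r < ‖c‖ ^ 2) :
    ∃ R : ℝ, r < pairWeight R c := by
  rw [lp_norm_sq] at hr
  obtain ⟨s, hs⟩ := ((lp_summable_sq c).hasSum.eventually (lt_mem_nhds hr)).exists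
  -- The sum of the distances over the finite set `s` bounds each of them.
  refine ⟨∑ p ∈ s, siteNorm (p.1 - p.2), hs.trans_le ?_⟩
  set R := ∑ p ∈ s, siteNorm (p.1 - p.2) with hR
  have h : pairWeight R c = ∑' p : Site × Site,
      Set.indicator {p : Site × Site | siteNorm (p.1 - p.2) ≤ R} (fun p => ‖c p‖ ^ 2) p :=
    tsum_subtype {p : Site × Site | siteNorm (p.1 - p.2) ≤ R} (fun p => ‖c p‖ ^ 2)
  rw [h]
  calc ∑ p ∈ s, ‖c p‖ ^ 2
      = ∑ p ∈ s, Set.indicator {p : Site × Site | siteNorm (p.1 - p.2) ≤ R}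
          (fun p => ‖c p‖ ^ 2) p := by
        refine Finset.sum_congr rfl fun p hp => ?_
        rw [Set.indicator_of_mem]
        exact Finset.single_le_sum (f := fun p : Site × Site => siteNorm (p.1 - p.2))
          (fun p _ => siteNorm_nonneg _) hp
    _ ≤ _ := ((lp_summable_sq c).indicator _).sum_le_tsum _
        fun p _ => Set.indicator_nonneg (fun p _ => by positivity) p

end Localization

/-! ### Energy bounds and locality of the interaction -/

section Energy

/-- The kinetic energy of one pair with unit hopping amplitude. -/
noncomputable def pairLaplacian :
    lp (fun _ : Site × Site => ℂ) 2 →L[ℂ] lp (fun _ : Site × Site => ℂ) 2 :=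
  -(1 / 2 : ℂ) • ∑ z ∈ nn, (pull (inj_up z) + pull (inj_down z))
    + (4 : ℂ) • ContinuousLinearMap.id ℂ _

/-- The kinetic energy of one boson with unit hopping amplitude. -/
noncomputable def boseLaplacian (hb : ℝ) :
    lp (fun _ : Site => ℂ) 2 →L[ℂ] lp (fun _ : Site => ℂ) 2 :=
  -(hb / 2 : ℂ) • ∑ z ∈ nn, shift z + (2 * hb : ℂ) • ContinuousLinearMap.id ℂ _

theorem norm_sum_pull_pair_le :
    ‖∑ z ∈ nn, (pull (inj_up z) + pull (inj_down z))‖ ≤ 8 := by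
  refine (norm_sum_le_of_le nn (f := fun z => pull (inj_up z) + pull (inj_down z))
    (n := fun _ => 2) fun z _ => ?_).trans ?_
  · refine (norm_add_le _ _).trans ?_
    linarith [norm_pull_le (inj_up z), norm_pull_le (inj_down z)]
  · rw [Finset.sum_const, show nn.card = 4 from rfl]; norm_num

theorem norm_sum_shift_le : ‖∑ z ∈ nn, shift z‖ ≤ 4 := by
  refine (norm_sum_le_of_le nn (f := fun z => shift z) (n := fun _ => 1)
    fun z _ => norm_pull_le _).trans ?_
  rw [Finset.sum_const, show nn.card = 4 from rfl]; norm_num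

theorem norm_pairLaplacian_le : ‖pairLaplacian‖ ≤ 8 := by
  refine (norm_add_le _ _).trans ?_
  rw [norm_smul, norm_smul]
  have h1 := norm_sum_pull_pair_le
  have h2 : ‖ContinuousLinearMap.id ℂ (lp (fun _ : Site × Site => ℂ) 2)‖ ≤ 1 :=
    ContinuousLinearMap.norm_id_le
  have h3 : ‖-(1 / 2 : ℂ)‖ = 1 / 2 := by norm_num
  have h4 : ‖(4 : ℂ)‖ = 4 := by norm_num
  rw [h3, h4]
  linarith

/-- By Cauchy–Schwarz the diagonal term `s` dominates the hopping term; both Laplacians are of this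
form with `r` times the norm bound equal to `s`. -/
theorem re_inner_neg_smul_add_nonneg {E : Type*} [NormedAddCommGroup E] [InnerProductSpace ℂ E]
    {N : E →L[ℂ] E} {r s : ℝ} (hr : 0 ≤ r) (h : r * ‖N‖ ≤ s) (c : E) :
    0 ≤ RCLike.re (inner ℂ c ((-(r : ℂ) • N + (s : ℂ) • ContinuousLinearMap.id ℂ E) c)) := by
  rw [add_apply, _root_.smul_apply, _root_.smul_apply,
    ContinuousLinearMap.id_apply, inner_add_right, inner_smul_right, inner_smul_right, map_add,
    ← Complex.ofReal_neg]
  change 0 ≤ (((-r : ℝ) : ℂ) * inner ℂ c (N c)).re + ((s : ℂ) * inner ℂ c c).re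
  rw [Complex.re_ofReal_mul, Complex.re_ofReal_mul]
  have h1 : (inner ℂ c c : ℂ).re = ‖c‖ ^ 2 := inner_self_eq_norm_sq (𝕜 := ℂ) c
  have h2 : (inner ℂ c (N c) : ℂ).re ≤ ‖N‖ * ‖c‖ ^ 2 := by
    calc (inner ℂ c (N c) : ℂ).re ≤ ‖c‖ * ‖N c‖ := re_inner_le_norm (𝕜 := ℂ) c (N c)
      _ ≤ ‖c‖ * (‖N‖ * ‖c‖) := by gcongr; exact N.le_opNorm c
      _ = _ := by ring
  rw [h1]
  nlinarith [mul_le_mul_of_nonneg_left h2 hr, mul_le_mul_of_nonneg_right h (sq_nonneg ‖c‖)]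

theorem re_inner_pairLaplacian_nonneg (c : lp (fun _ : Site × Site => ℂ) 2) :
    0 ≤ RCLike.re (inner ℂ c (pairLaplacian c)) := by
  have := re_inner_neg_smul_add_nonneg
    (N := ∑ z ∈ nn, (pull (inj_up z) + pull (inj_down z))) (r := 1 / 2) (s := 4) (by norm_num)
    (by linarith [norm_sum_pull_pair_le]) c
  push_cast at this
  exact this

theorem re_inner_boseLaplacian_nonneg {hb : ℝ} (hhb : 0 ≤ hb) (b : lp (fun _ : Site => ℂ) 2) :
    0 ≤ RCLike.re (inner ℂ b (boseLaplacian hb b)) := by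
  have := re_inner_neg_smul_add_nonneg (N := ∑ z ∈ nn, shift z) (r := hb / 2) (s := 2 * hb) (by positivity)
    (by nlinarith [norm_sum_shift_le]) b
  push_cast at this
  exact this

theorem re_inner_diagOp_nonneg (c : lp (fun _ : Site × Site => ℂ) 2) :
    0 ≤ RCLike.re (inner ℂ c (diagOp c)) := by
  rw [diagOp, ContinuousLinearMap.comp_apply, ContinuousLinearMap.adjoint_inner_right]
  exact inner_self_nonneg

theorem re_inner_sectorOp (hop U hb κ : ℝ) (v : Coupling) (ψ : Sector) :
    RCLike.re (inner ℂ ψ (sectorOp hop U hb κ v ψ)) =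
      hop * (RCLike.re (inner ℂ ψ.fst (pairLaplacian ψ.fst)) +
        RCLike.re (inner ℂ ψ.snd (boseLaplacian hb ψ.snd))) +
      U * RCLike.re (inner ℂ ψ.fst (diagOp ψ.fst)) +
      2 * RCLike.re (inner ℂ ((convOp v ∘L pairOp κ) ψ.fst) ψ.snd) := by
  have hf : (sectorOp hop U hb κ v ψ).fst =
      ((hop : ℂ) • pairLaplacian ψ.fst + (U : ℂ) • diagOp ψ.fst) +
        ContinuousLinearMap.adjoint (convOp v ∘L pairOp κ) ψ.snd := rfl
  have hs : (sectorOp hop U hb κ v ψ).snd = (convOp v ∘L pairOp κ) ψ.fst +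
    (hop : ℂ) • boseLaplacian hb ψ.snd := rfl
  rw [sector_inner, hf, hs]
  generalize convOp v ∘L pairOp κ = A
  rw [inner_add_right, inner_add_right, inner_add_right, inner_smul_right, inner_smul_right,
    inner_smul_right, ContinuousLinearMap.adjoint_inner_right, map_add, map_add, map_add, map_add,
    inner_re_symm ψ.snd]
  have hre : ∀ (r : ℝ) (z : ℂ), RCLike.re ((r : ℂ) * z) = r * RCLike.re z :=
    fun r z => Complex.re_ofReal_mul r z
  rw [hre, hre, hre]
  ring

/-- Kinetic energy and repulsion are nonnegative; only the exchange term is estimated. -/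
theorem neg_le_re_inner_sectorOp {hop U hb : ℝ} (hhop : 0 ≤ hop) (hU : 0 ≤ U) (hhb : 0 ≤ hb)
    (κ : ℝ) (v : Coupling) (ψ : Sector) :
    -(2 * ‖convOp v ∘L pairOp κ‖ * ‖ψ.fst‖ * ‖ψ.snd‖) ≤
      RCLike.re (inner ℂ ψ (sectorOp hop U hb κ v ψ)) := by
  rw [re_inner_sectorOp]
  have h1 := mul_nonneg hhop (add_nonneg (re_inner_pairLaplacian_nonneg ψ.fst)
    (re_inner_boseLaplacian_nonneg hhb ψ.snd))
  have h2 := mul_nonneg hU (re_inner_diagOp_nonneg ψ.fst)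
  generalize convOp v ∘L pairOp κ = A
  have h3 : |RCLike.re (inner ℂ (A ψ.fst) ψ.snd)| ≤ ‖A‖ * ‖ψ.fst‖ * ‖ψ.snd‖ :=
    (RCLike.abs_re_le_norm _).trans ((norm_inner_le_norm _ _).trans
      (by gcongr; exact A.le_opNorm _))
  linarith [neg_abs_le (RCLike.re (inner ℂ (A ψ.fst) ψ.snd))]

/-- The repulsion acts on the diagonal and the exchange creates pairs at distance at most one, so
neither reaches the region beyond. -/
theorem pull_far_sectorOp (hop U hb κ : ℝ) (v : Coupling) (ψ : Sector) :
    pull (Subtype.val_injective (p := fun p : Site × Site => ¬ siteNorm (p.1 - p.2) ≤ 1))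
        (sectorOp hop U hb κ v ψ).fst =
      (hop : ℂ) • pull (Subtype.val_injective
        (p := fun p : Site × Site => ¬ siteNorm (p.1 - p.2) ≤ 1)) (pairLaplacian ψ.fst) := by
  have hf : (sectorOp hop U hb κ v ψ).fst =
      ((hop : ℂ) • pairLaplacian ψ.fst + (U : ℂ) • diagOp ψ.fst) +
        ContinuousLinearMap.adjoint (convOp v ∘L pairOp κ) ψ.snd := rfl
  ext ⟨⟨x, y⟩, h⟩
  have h1 : diagOp ψ.fst (x, y) = 0 := by
    rw [diagOp_apply, if_neg]
    rintro rfl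
    simp [siteNorm] at h
  have h2 : ContinuousLinearMap.adjoint (convOp v ∘L pairOp κ) ψ.snd (x, y) = 0 := by
    rw [ContinuousLinearMap.adjoint_comp, ContinuousLinearMap.comp_apply, pairOp_adjoint_apply]
    refine Finset.sum_eq_zero fun z hz => ?_
    rw [if_neg, mul_zero]
    rintro rfl
    simp only [WaveFunction.closeSites, Finset.mem_filter] at hz
    exact h (by simpa using hz.2)
  rw [hf, pull_apply, lp.coeFn_add, Pi.add_apply, lp.coeFn_add, Pi.add_apply, h2, lp.coeFn_smul,
    lp.coeFn_smul, Pi.smul_apply, Pi.smul_apply, h1]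
  simp only [smul_zero, add_zero]
  rfl

end Energy

/-! ### Low-energy states -/

section LowEnergy

variable {hop U hb κ ε : ℝ} {v : Coupling}

theorem re_inner_le_of_mem_lowEnergySpace {ψ : Sector}
    (hψ : ψ ∈ lowEnergySpace hop U hb κ v ε) :
    RCLike.re (inner ℂ ψ (sectorHamiltonian hop U hb κ v ψ)) ≤
      groundEnergy hop U hb κ v * (1 - ε) * ‖ψ‖ ^ 2 :=
  re_inner_le_of_mem_spectralSubspace (isSelfAdjoint_sectorHamiltonian hop U hb κ v) hψ

/-- Low-energy states have a substantial fermionic component. -/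
theorem mul_norm_le_of_mem_lowEnergySpace (hhop : 0 ≤ hop) (hU : 0 ≤ U) (hhb : 0 ≤ hb)
    {ψ : Sector} (hψ : ψ ∈ lowEnergySpace hop U hb κ v ε) :
    -(groundEnergy hop U hb κ v * (1 - ε)) * ‖ψ‖ ^ 2 ≤
      2 * ‖convOp v ∘L pairOp κ‖ * ‖ψ.fst‖ * ‖ψ.snd‖ := by
  have h1 := re_inner_le_of_mem_lowEnergySpace hψ
  rw [sectorHamiltonian_eq_sectorOp] at h1
  have h2 := neg_le_re_inner_sectorOp hhop hU hhb κ v ψ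
  linarith

/-- Conservation applies with the boson component as the equivariant map `β` and the projection onto
near pairs as the observable. -/
theorem pairWeight_const (hhop : 0 ≤ hop) (hU : 0 ≤ U) (hhb : 0 ≤ hb) (hε : ε < 1)
    (hE : groundEnergy hop U hb κ v < 0) {ψ : ℝ → Sector}
    (hψ : ψ ∈ lowEnergySolutions hop U hb κ v ε) (R t s : ℝ) :
    pairWeight R (ψ t).fst = pairWeight R (ψ s).fst := by
  have hsa := isSelfAdjoint_sectorHamiltonian hop U hb κ v
  have hcomm : ∀ a, Commute (sectorHamiltonian hop U hb κ v) (translation a) := fun a => by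
    rw [sectorHamiltonian_eq_sectorOp]
    exact commute_sectorOp_translation hop U hb κ v a
  -- Without a boson component the exchange energy vanishes, which is incompatible with strictly
  -- negative energy.
  have hinj : ∀ φ ∈ lowEnergySpace hop U hb κ v ε, WithLp.sndL 2 ℂ _ _ φ = 0 → φ = 0 := by
    intro φ hφ h0
    have h0' : φ.snd = 0 := h0
    have h := mul_norm_le_of_mem_lowEnergySpace hhop hU hhb hφ
    rw [h0', norm_zero, mul_zero] at h
    have h1 : 0 < -(groundEnergy hop U hb κ v * (1 - ε)) := by nlinarith
    have h2 : ‖φ‖ ^ 2 ≤ 0 := by by_contra hn; nlinarith [mul_pos h1 (not_le.1 hn)]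
    exact norm_eq_zero.1 (pow_eq_zero_iff two_ne_zero |>.1 (le_antisymm h2 (sq_nonneg _)))
  have h := inner_apply_const (lowEnergySpace hop U hb κ v ε) (isClosed_spectralSubspace _ _)
    translation adjoint_translation (fun a φ hφ => map_mem_spectralSubspace hsa (hcomm a) hφ)
    (WithLp.sndL 2 ℂ _ _) (fun _ => rfl) hinj hcomm (commute_near_translation R) hsa
    (fun φ hφ => map_mem_spectralSubspace hsa (Commute.refl _) hφ)
    (hψ.1.differentiable one_ne_zero) hψ.2.1 hψ.2.2.2 t s
  rw [ContinuousLinearMap.comp_apply, ContinuousLinearMap.comp_apply,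
    ContinuousLinearMap.adjoint_inner_right, ContinuousLinearMap.adjoint_inner_right,
    inner_self_eq_norm_sq_to_K, inner_self_eq_norm_sq_to_K] at h
  rw [← norm_nearRestrict_sq, ← norm_nearRestrict_sq]
  exact_mod_cast h

theorem norm_snd_le (ψ : Sector) : ‖ψ.snd‖ ≤ ‖ψ‖ := by
  have := WithLp.prod_norm_sq_eq_of_L2 ψ
  exact le_of_sq_le_sq (by nlinarith [sq_nonneg ‖ψ.fst‖]) (norm_nonneg _)

theorem norm_fst_le (ψ : Sector) : ‖ψ.fst‖ ≤ ‖ψ‖ := by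
  have := WithLp.prod_norm_sq_eq_of_L2 ψ
  exact le_of_sq_le_sq (by nlinarith [sq_nonneg ‖ψ.snd‖]) (norm_nonneg _)

/-- Bounding `‖ψ.snd‖` by `‖ψ‖` cancels one factor and leaves a lower bound, linear in `‖ψ‖`, for
the pair component. -/
theorem mul_norm_le_mul_norm_fst (hhop : 0 ≤ hop) (hU : 0 ≤ U) (hhb : 0 ≤ hb)
    {ψ : Sector} (hψ : ψ ∈ lowEnergySpace hop U hb κ v ε) :
    -(groundEnergy hop U hb κ v * (1 - ε)) * ‖ψ‖ ≤
      2 * ‖convOp v ∘L pairOp κ‖ * ‖ψ.fst‖ := by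
  have h := mul_norm_le_of_mem_lowEnergySpace hhop hU hhb hψ
  rcases (norm_nonneg ψ).eq_or_lt with h0 | h0
  · rw [← h0, mul_zero]; positivity
  · refine le_of_mul_le_mul_right ?_ h0
    calc _ = -(groundEnergy hop U hb κ v * (1 - ε)) * ‖ψ‖ ^ 2 := by ring
      _ ≤ _ := h
      _ ≤ _ := by gcongr; exact norm_snd_le ψ

theorem norm_fst_pos (hhop : 0 ≤ hop) (hU : 0 ≤ U) (hhb : 0 ≤ hb) (hε : ε < 1)
    (hE : groundEnergy hop U hb κ v < 0) {ψ : Sector}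
    (hψ : ψ ∈ lowEnergySpace hop U hb κ v ε) (h1 : ‖ψ‖ = 1) : 0 < ‖ψ.fst‖ := by
  have h := mul_norm_le_mul_norm_fst hhop hU hhb hψ
  rw [h1, mul_one] at h
  refine (norm_nonneg _).lt_of_ne fun h0 => ?_
  rw [← h0, mul_zero] at h
  nlinarith

/-- Far apart, only the hopping contributes to the pair component of `H ψ`. -/
theorem norm_far_le (hhop : 0 ≤ hop) (hε : ε < 1)
    (hE : groundEnergy hop U hb κ v < 0) {ψ : Sector}
    (hψ : ψ ∈ lowEnergySpace hop U hb κ v ε) :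
    ‖pull (Subtype.val_injective (p := fun p : Site × Site => ¬ siteNorm (p.1 - p.2) ≤ 1)) ψ.fst‖ ≤
      hop * (8 * ((-(groundEnergy hop U hb κ v * (1 - ε)))⁻¹ * ‖ψ‖)) := by
  have hδ : 0 < -(groundEnergy hop U hb κ v * (1 - ε)) := by nlinarith
  -- Writing `ψ = H φ` brings in the locality of the interaction and produces the factor `hop`.
  obtain ⟨φ, rfl, hφ⟩ := exists_apply_eq_of_mem_spectralSubspace
    (isSelfAdjoint_sectorHamiltonian hop U hb κ v) hδ
    (a := groundEnergy hop U hb κ v) (ψ := ψ) (by rw [neg_neg]; exact hψ)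
  rw [sectorHamiltonian_eq_sectorOp] at hφ ⊢
  rw [pull_far_sectorOp, norm_smul, Complex.norm_real, Real.norm_of_nonneg hhop]
  gcongr
  refine (ContinuousLinearMap.le_of_opNorm_le _ (norm_pull_le _) _).trans ?_
  rw [one_mul]
  refine (ContinuousLinearMap.le_of_opNorm_le _ norm_pairLaplacian_le _).trans ?_
  gcongr
  exact (norm_fst_le φ).trans hφ

/-- If the exchange coupling does not vanish, then the ground state energy is bounded away from
zero for small hopping amplitudes. -/
theorem exists_groundEnergy_le (U hb κ : ℝ) (v : Coupling) (hA : convOp v ∘L pairOp κ ≠ 0) :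
    ∃ e > 0, ∃ r > 0, ∀ hop, 0 < hop → hop < r → groundEnergy hop U hb κ v ≤ -e := by
  obtain ⟨c, hc⟩ : ∃ c, (convOp v ∘L pairOp κ) c ≠ 0 := by
    by_contra! h
    exact hA (ContinuousLinearMap.ext h)
  set A := convOp v ∘L pairOp κ with hAdef
  set u := U * RCLike.re (inner ℂ c (diagOp c)) with hu
  have hpos : 0 < ‖A c‖ ^ 2 := by positivity
  -- Trial state `(c, s A c)`: this `s` makes repulsion plus exchange equal to `-1`, leaving energy
  -- `hop * q - 1`.
  set s : ℝ := -((u + 1) / (2 * ‖A c‖ ^ 2)) with hs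
  let ψ : Sector := WithLp.toLp 2 (c, (s : ℂ) • A c)
  set q := RCLike.re (inner ℂ ψ.fst (pairLaplacian ψ.fst)) +
    RCLike.re (inner ℂ ψ.snd (boseLaplacian hb ψ.snd)) with hq
  have henergy : ∀ hop, RCLike.re (inner ℂ ψ (sectorOp hop U hb κ v ψ)) = hop * q - 1 := by
    intro hop
    rw [re_inner_sectorOp, ← hq, ← hAdef]
    change hop * q + u + 2 * RCLike.re (inner ℂ (A c) ((s : ℂ) • A c)) = _
    rw [inner_smul_right]
    change hop * q + u + 2 * ((s : ℂ) * inner ℂ (A c) (A c)).re = _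
    rw [Complex.re_ofReal_mul]
    have : (inner ℂ (A c) (A c) : ℂ).re = ‖A c‖ ^ 2 := inner_self_eq_norm_sq (𝕜 := ℂ) _
    rw [this, hs]
    field_simp
    ring
  have hψ : 0 < ‖ψ‖ ^ 2 := by
    have : ψ ≠ 0 := by
      intro h
      have h1 := henergy 0
      rw [h, map_zero, inner_zero_right, map_zero] at h1
      norm_num at h1
    positivity
  -- For `hop < r` the kinetic part is at most `1/2`, so the energy is at most `-1/2`; division by
  -- `‖ψ‖²` gives `e`.
  refine ⟨1 / (2 * ‖ψ‖ ^ 2), by positivity, 1 / (2 * (|q| + 1)), by positivity,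
    fun hop h0 h1 => ?_⟩
  have h2 := spectrumBottom_mul_le (isSelfAdjoint_sectorHamiltonian hop U hb κ v) ψ
  rw [sectorHamiltonian_eq_sectorOp, henergy] at h2
  rw [lt_div_iff₀ (by positivity)] at h1
  have h3 : hop * q ≤ 1 / 2 := by
    nlinarith [le_abs_self q, mul_le_mul_of_nonneg_left (le_abs_self q) h0.le]
  rw [groundEnergy, sectorHamiltonian_eq_sectorOp, ← neg_div, le_div_iff₀ (by positivity)]
  nlinarith

end LowEnergy

end BipolaronElectron

/-! ### Bound pairs at low energy -/

theorem theorem3p2 (U hb κ : ℝ) (hU : 0 ≤ U) (hhb : 0 ≤ hb) (hκ : 0 < κ) (v : Coupling)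
    (η ε : ℝ) (hη : η ∈ Set.Ioo (0 : ℝ) 1) (hε : ε ∈ Set.Ioo (0 : ℝ) 1) :
    (∀ hop : ℝ, 0 ≤ hop → groundEnergy hop U hb κ v < 0 →
      ∀ ψ ∈ lowEnergySolutions hop U hb κ v ε, ∃ R : ℝ, ∀ t : ℝ,
        ‖(ψ 0).fst‖ ^ 2 * (1 - η) ≤ pairWeight R (ψ t).fst ∧
        0 < ‖(ψ 0).fst‖ ^ 2 * (1 - η)) ∧
    (∃ hop₀ : ℝ, 0 < hop₀ ∧ ∀ hop : ℝ, 0 < hop → hop < hop₀ → groundEnergy hop U hb κ v < 0 →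
      ∀ ψ ∈ lowEnergySolutions hop U hb κ v ε, ∀ t : ℝ,
        ‖(ψ 0).fst‖ ^ 2 * (1 - η) ≤ pairWeight 1 (ψ t).fst ∧
        0 < ‖(ψ 0).fst‖ ^ 2 * (1 - η)) := by
  have hη1 : 0 < 1 - η := sub_pos.2 hη.2
  have hε1 : 0 < 1 - ε := sub_pos.2 hε.2
  have hpos : ∀ hop : ℝ, 0 ≤ hop → groundEnergy hop U hb κ v < 0 →
      ∀ ψ ∈ lowEnergySolutions hop U hb κ v ε, 0 < ‖(ψ 0).fst‖ ^ 2 := fun hop h0 hE ψ hψ =>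
    pow_pos (norm_fst_pos h0 hU hhb hε.2 hE (hψ.2.1 0) (hψ.2.2.1 0)) 2
  constructor
  · intro hop h0 hE ψ hψ
    have hp := hpos hop h0 hE ψ hψ
    obtain ⟨R, hR⟩ := exists_lt_pairWeight (ψ 0).fst
      (show ‖(ψ 0).fst‖ ^ 2 * (1 - η) < ‖(ψ 0).fst‖ ^ 2 by nlinarith [hη.1])
    refine ⟨R, fun t => ⟨?_, mul_pos hp hη1⟩⟩
    rw [pairWeight_const h0 hU hhb hε.2 hE hψ R t 0]
    exact hR.le
  · by_cases hA : convOp v ∘L pairOp κ = 0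
    -- Without exchange the hypotheses are contradictory, so any threshold serves.
    · refine ⟨1, one_pos, fun hop h0 _ hE ψ hψ => ?_⟩
      have h := mul_norm_le_mul_norm_fst h0.le hU hhb (hψ.2.1 0)
      rw [hA, norm_zero, hψ.2.2.1 0] at h
      nlinarith
    · obtain ⟨e, he, r, hr, hle⟩ := exists_groundEnergy_le U hb κ v hA
      set N := ‖convOp v ∘L pairOp κ‖ with hN
      have hN0 : 0 ≤ N := norm_nonneg _
      set d := e * (1 - ε) with hd
      have hd0 : 0 < d := mul_pos he hε1
      have hsη : 0 < Real.sqrt η := Real.sqrt_pos.2 hη.1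
      -- The factor `16 = 8 * 2` combines the norm bound of the pair Laplacian with the factor of
      -- the exchange estimate. The far part is then at most `√η` times the pair norm, so its weight
      -- is at most the fraction `η`. The `+ 1` keeps the denominator positive.
      refine ⟨min r (Real.sqrt η / (16 * N / d ^ 2 + 1)), by positivity,
        fun hop h0 h1 hE ψ hψ t => ⟨?_, mul_pos (hpos hop h0.le hE ψ hψ) hη1⟩⟩
      rw [pairWeight_const h0.le hU hhb hε.2 hE hψ 1 t 0]
      have hmem := hψ.2.1 0
      have hfar := norm_far_le h0.le hε.2 hE hmem
      have hfst := mul_norm_le_mul_norm_fst h0.le hU hhb hmem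
      rw [← hN] at hfst
      have hdδ : d ≤ -(groundEnergy hop U hb κ v * (1 - ε)) := by
        nlinarith [hle hop h0 (h1.trans_le (min_le_left _ _))]
      set δ := -(groundEnergy hop U hb κ v * (1 - ε)) with hδ
      have h2 : hop * (16 * N / d ^ 2) ≤ Real.sqrt η := by
        have := (lt_div_iff₀ (by positivity)).1 (h1.trans_le (min_le_right _ _))
        nlinarith
      have h3 : ‖ψ 0‖ ≤ 2 * N * ‖(ψ 0).fst‖ / d := by
        rw [le_div_iff₀ hd0]
        nlinarith [mul_le_mul_of_nonneg_right hdδ (norm_nonneg (ψ 0))]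
      have h4 : δ⁻¹ ≤ d⁻¹ := inv_anti₀ hd0 hdδ
      have h5 := calc
        _ ≤ hop * (8 * (δ⁻¹ * ‖ψ 0‖)) := hfar
        _ ≤ hop * (8 * (d⁻¹ * (2 * N * ‖(ψ 0).fst‖ / d))) := by gcongr
        _ = hop * (16 * N / d ^ 2) * ‖(ψ 0).fst‖ := by field_simp; ring
        _ ≤ Real.sqrt η * ‖(ψ 0).fst‖ := by gcongr
      have h6 := pow_le_pow_left₀ (norm_nonneg _) h5 2
      rw [mul_pow, Real.sq_sqrt hη.1.le] at h6
      have h7 := pairWeight_add_norm_pull_sq 1 (ψ 0).fst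
      linarith
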